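/- Let $K$ be a field of characteristic zero, let $n\ge 1$, and let $a,b,c,d\ge 0$ be integers with $a+b=c+d=n$. Let $e_1,\dots,e_n$ be the standard basis of $K^n$. The opposite maximal parabolic seaweed algebra $\mathfrak p(a,b\mid c,d)$ is the Lie algebra of all traceless matrices $A\in\mathfrak{sl}_n(K)$ that preserve the subspaces $\operatorname{span}\{e_1,\dots,e_a\}$ and $\operatorname{span}\{e_{c+1},\dots,e_n\}$, that is, the two flags $0\subset \operatorname{span}\{e_1,\dots,e_a\}\subset K^n$ and $K^n\supset\operatorname{span}\{e_{c+1},\dots,e_n\}\supset 0$. For a finite-dimensional Lie algebra $\mathfrak L$ over $K$ and $F\in\mathfrak L^*$ put $B_F(x,y)=F([x,y])$; the index of $\mathfrak L$ is $\min_{F\in\mathfrak L^*}\dim\ker B_F$, and $\mathfrak L$ is called Frobenius if its index is $0$. Then $\mathfrak p(a,b\mid c,d)$ is Frobenius if and only if $\gcd(a-c,n)=1$. -/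

import Mathlib

attribute [local instance 100] LieRing.ofAssociativeRing

/-- The skew bilinear form `B_F(x, y) = F([x, y])` attached to a functional `F` on a Lie algebra. -/
def kirillovForm {K L : Type*} [Field K] [LieRing L] [LieAlgebra K L] (F : Module.Dual K L) :
    L →ₗ[K] L →ₗ[K] K :=
  LinearMap.mk₂ K (fun x y => F ⁅x, y⁆)
    (fun x x' y => by rw [add_lie, map_add])
    (fun t x y => by rw [smul_lie, map_smul])
    (fun x y y' => by rw [lie_add, map_add])
    (fun t x y => by rw [lie_smul, map_smul])

/-- The index of a finite-dimensional Lie algebra: the minimum, over all functionals `F`, of the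
dimension of the kernel of `B_F`. -/
noncomputable def lieIndex (K L : Type*) [Field K] [LieRing L] [LieAlgebra K L]
    [FiniteDimensional K L] : ℕ :=
  ⨅ F : Module.Dual K L, Module.finrank K (LinearMap.ker (kirillovForm F))

/-- A finite-dimensional Lie algebra is Frobenius if its index is zero. -/
def IsFrobeniusLie (K L : Type*) [Field K] [LieRing L] [LieAlgebra K L]
    [FiniteDimensional K L] : Prop :=
  lieIndex K L = 0

/-- `V_i = span {e_1, …, e_{a_1 + ⋯ + a_i}}` for `x = (a_1, …, a_m)`
(the basis vectors are indexed from `0` here). -/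
def upperFlag (K : Type*) [Field K] (n : ℕ) (x : List ℕ) (i : ℕ) : Submodule K (Fin n → K) :=
  Submodule.span K {v | ∃ k : Fin n, (k : ℕ) < (x.take i).sum ∧ v = Pi.single k 1}

/-- `W_j = span {e_{b_1 + ⋯ + b_j + 1}, …, e_n}` for `y = (b_1, …, b_t)`
(the basis vectors are indexed from `0` here). -/
def lowerFlag (K : Type*) [Field K] (n : ℕ) (y : List ℕ) (j : ℕ) : Submodule K (Fin n → K) :=
  Submodule.span K {v | ∃ k : Fin n, (y.take j).sum ≤ (k : ℕ) ∧ v = Pi.single k 1}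

/-- The Lie algebra of all matrices that preserve a given subspace of `K ^ n`. -/
def stabilizerLie {K : Type*} [Field K] {n : ℕ} (U : Submodule K (Fin n → K)) :
    LieSubalgebra K (Matrix (Fin n) (Fin n) K) where
  carrier := {A | ∀ v ∈ U, A.mulVec v ∈ U}
  zero_mem' := fun v _ => by
    rw [Matrix.zero_mulVec]
    exact U.zero_mem
  add_mem' := fun {A B} hA hB v hv => by
    rw [Matrix.add_mulVec]
    exact U.add_mem (hA v hv) (hB v hv)
  smul_mem' := fun t A hA v hv => by
    rw [Matrix.smul_mulVec]
    exact U.smul_mem t (hA v hv)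
  lie_mem' := fun {A B} hA hB v hv => by
    rw [Ring.lie_def, Matrix.sub_mulVec, ← Matrix.mulVec_mulVec, ← Matrix.mulVec_mulVec]
    exact U.sub_mem (hA _ (hB v hv)) (hB _ (hA v hv))

/-- The seaweed Lie algebra `p(x | y)`: the traceless `n × n` matrices that preserve both the flag
`V_0 ⊂ V_1 ⊂ ⋯ ⊂ V_m` of `x` and the flag `W_0 ⊃ W_1 ⊃ ⋯ ⊃ W_t` of `y`. It is meant for
compositions `x` and `y` of `n`. -/
def seaweed (K : Type*) [Field K] (n : ℕ) (x y : List ℕ) :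
    LieSubalgebra K (Matrix (Fin n) (Fin n) K) :=
  LieAlgebra.SpecialLinear.sl (Fin n) K
    ⊓ (⨅ i : Fin (x.length + 1), stabilizerLie (upperFlag K n x i))
    ⊓ (⨅ j : Fin (y.length + 1), stabilizerLie (lowerFlag K n y j))

/-! Scalars split off in characteristic zero, so the seaweed algebra is Frobenius exactly when some
functional on the stabilizer of two subspaces `U`, `W` in `gl(V)` has a commutator form whose kernel
consists of scalars. This property of a pair depends only on the dimensions of `V`, `U`, `W` and `U
⊓ W`, and it survives passage to annihilators.

For a flag `N ≤ N ⊕ B` in `N ⊕ Q`, with blocks of sizes `A`, `B`, `C`, the stabilizer is the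
semidirect product of `gl(N) × stab(B)` with the abelian ideal `Hom(Q, N)`. A functional restricts
to this ideal as `v ↦ tr (φ ∘ v)` with `φ : N → Q`. The kernel is minimal if and only if `φ` has an
open orbit and its stabilizer is again Frobenius modulo scalars (`isFrobeniusPair_nested_iff`). An
open orbit forces `φ` to be injective or surjective.

If `φ` is injective, its image must be in general position to `B`, and its stabilizer is that of the
pair `(range φ, B)` in `Q`. Generic pairs thus correspond to flags, and the symmetry of a pair gives
`isFrobeniusFlag_swap`. If `φ` is surjective, its stabilizer is that of a flag with first block
smaller by `B + C` (`isFrobeniusFlag_add_left`). With duality, which reverses the blocks, these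
moves form a Euclidean algorithm preserving `gcd (A + B, B + C)`, whence `isFrobeniusFlag_iff_gcd`.
The seaweed pair is the generic pair attached to the blocks `a`, `d`, `c`, and `gcd (a + d, d + c) =
gcd (a - c, n)`. -/

open Module

/-! ### Kernel of the form on a semidirect product with an abelian ideal -/

section SemidirectForm

variable {K H V : Type*} [Field K] [AddCommGroup H] [Module K H] [AddCommGroup V] [Module K V]

/-- For the form `β(x, x') + D x v' - D x' v` on `H × V`, the kernel consists of the multiples of
`(e, 0)` if and only if `D` is nondegenerate on `V` and the kernel of `β` on `ker D` consists of
the multiples of `e`. -/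
theorem semidirect_kernel_iff [FiniteDimensional K V] (β : H →ₗ[K] H →ₗ[K] K)
    (D : H →ₗ[K] Dual K V) (e : H) (hβe : ∀ x, β e x = 0) :
    (∀ (x : H) (v : V), (∀ (x' : H) (v' : V), β x x' + D x v' - D x' v = 0) →
        ∃ t : K, x = t • e ∧ v = 0) ↔
      (∀ v, (∀ x, D x v = 0) → v = 0) ∧
        ∀ x, D x = 0 → (∀ y, D y = 0 → β x y = 0) → ∃ t : K, x = t • e := by
  constructor
  · intro h
    refine ⟨fun v hv => ?_, fun x hx hxy => ?_⟩
    · obtain ⟨t, -, h2⟩ := h 0 v (by simp [hv])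
      exact h2
    · have hmem : β x ∈ LinearMap.range D.dualMap := by
        rw [LinearMap.range_dualMap_eq_dualAnnihilator_ker, Submodule.mem_dualAnnihilator]
        exact hxy
      obtain ⟨ξ, hξ⟩ := hmem
      obtain ⟨v, rfl⟩ := (evalEquiv K V).surjective ξ
      have hv : ∀ y, D y v = β x y := fun y => by
        rw [← hξ]; rfl
      obtain ⟨t, h1, -⟩ := h x v (by simp [hx, hv])
      exact ⟨t, h1⟩
  · rintro ⟨h1, h2⟩ x v hxv
    have hx : D x = 0 := by
      ext v'
      simpa using hxv 0 v'
    obtain ⟨t, rfl⟩ := h2 x hx fun y hy => by simpa [hx, hy] using hxv y 0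
    refine ⟨t, rfl, h1 v fun y => ?_⟩
    simpa [hβe] using hxv y 0

end SemidirectForm

/-! ### Trace duality between `Hom(Q, N)` and `Hom(N, Q)` -/

section TracePairing

variable {K N Q : Type*} [Field K] [AddCommGroup N] [Module K N] [AddCommGroup Q] [Module K Q]

theorem eq_zero_of_forall_trace_comp_eq_zero [FiniteDimensional K Q] (φ : N →ₗ[K] Q)
    (h : ∀ v : Q →ₗ[K] N, LinearMap.trace K Q (φ ∘ₗ v) = 0) : φ = 0 := by
  ext m
  rw [LinearMap.zero_apply, ← Module.forall_dual_apply_eq_zero_iff K]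
  intro ξ
  rw [← LinearMap.trace_smulRight ξ (φ m), ← h (ξ.smulRight m)]
  congr 1
  ext q
  simp

/-- Every functional on `Hom(Q, N)` is `v ↦ tr (φ ∘ v)` for some `φ : N → Q`. -/
theorem exists_forall_apply_eq_trace_comp [FiniteDimensional K N] [FiniteDimensional K Q]
    (ψ : Dual K (Q →ₗ[K] N)) : ∃ φ : N →ₗ[K] Q, ∀ v, ψ v = LinearMap.trace K Q (φ ∘ₗ v) := by
  let T : (N →ₗ[K] Q) →ₗ[K] Dual K (Q →ₗ[K] N) :=
    LinearMap.mk₂ K (fun φ v => LinearMap.trace K Q (φ ∘ₗ v))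
      (fun φ φ' v => by rw [LinearMap.add_comp, map_add])
      (fun t φ v => by rw [LinearMap.smul_comp, map_smul])
      (fun φ v v' => by rw [LinearMap.comp_add, map_add])
      (fun t φ v => by rw [LinearMap.comp_smul, map_smul])
  have hinj : Function.Injective T := by
    rw [injective_iff_map_eq_zero]
    intro φ hφ
    exact eq_zero_of_forall_trace_comp_eq_zero φ fun v => LinearMap.congr_fun hφ v
  have hdim : finrank K (N →ₗ[K] Q) = finrank K (Dual K (Q →ₗ[K] N)) := by
    rw [Subspace.dual_finrank_eq, finrank_linearMap, finrank_linearMap, mul_comm]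
  obtain ⟨φ, hφ⟩ := (LinearMap.injective_iff_surjective_of_finrank_eq_finrank hdim).1 hinj ψ
  exact ⟨φ, fun v => by rw [← hφ]; rfl⟩

end TracePairing

/-! ### Frobenius pairs of subspaces -/

section Pairs

variable {K V : Type*} [Field K] [AddCommGroup V] [Module K V]

/-- The algebra of endomorphisms preserving `U` and `W` carries a functional `F` such that the
kernel of `(x, y) ↦ F (x y - y x)` consists of scalars. -/
def IsFrobeniusPair (U W : Submodule K V) : Prop :=
  ∃ F : Dual K (End K V), ∀ x : End K V, U ≤ U.comap x → W ≤ W.comap x →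
    (∀ y : End K V, U ≤ U.comap y → W ≤ W.comap y → F (x * y - y * x) = 0) → ∃ t : K, x = t • 1

theorem isFrobeniusPair_comm (U W : Submodule K V) :
    IsFrobeniusPair U W ↔ IsFrobeniusPair W U := by
  constructor <;> rintro ⟨F, hF⟩ <;>
    exact ⟨F, fun x h1 h2 h3 => hF x h2 h1 fun y hy1 hy2 => h3 y hy2 hy1⟩

theorem isFrobeniusPair_bot_left (U : Submodule K V) :
    IsFrobeniusPair ⊥ U ↔ IsFrobeniusPair U U := by
  constructor
  · rintro ⟨F, hF⟩
    exact ⟨F, fun x h1 h2 h3 => hF x bot_le h1 fun y _ hy => h3 y hy hy⟩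
  · rintro ⟨F, hF⟩
    exact ⟨F, fun x _ h2 h3 => hF x h2 h2 fun y hy _ => h3 y bot_le hy⟩

end Pairs

/-! ### Block form of the stabilizer of a two-step flag -/

section Blocks

variable {K N Q : Type*} [Field K] [AddCommGroup N] [Module K N] [AddCommGroup Q] [Module K Q]

/-- The block upper triangular endomorphism of `N × Q` with the given blocks. -/
def upperBlock (x : End K N) (z : End K Q) (v : Q →ₗ[K] N) : End K (N × Q) :=
  (x.coprod v).prod (z ∘ₗ LinearMap.snd K N Q)

@[simp]
theorem upperBlock_apply (x : End K N) (z : End K Q) (v : Q →ₗ[K] N) (p : N × Q) :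
    upperBlock x z v p = (x p.1 + v p.2, z p.2) := rfl

theorem upperBlock_mul (x x' : End K N) (z z' : End K Q) (v v' : Q →ₗ[K] N) :
    upperBlock x z v * upperBlock x' z' v' =
      upperBlock (x * x') (z * z') (x ∘ₗ v' + v ∘ₗ z') := by
  apply LinearMap.ext
  intro p
  simp [add_assoc]

theorem upperBlock_sub (x x' : End K N) (z z' : End K Q) (v v' : Q →ₗ[K] N) :
    upperBlock x z v - upperBlock x' z' v' = upperBlock (x - x') (z - z') (v - v') := by
  apply LinearMap.ext
  intro p
  simp only [LinearMap.sub_apply, upperBlock_apply, Prod.mk_sub_mk]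
  congr 1
  abel

theorem upperBlock_eq_smul_one_iff (x : End K N) (z : End K Q) (v : Q →ₗ[K] N) (t : K) :
    upperBlock x z v = t • 1 ↔ x = t • 1 ∧ z = t • 1 ∧ v = 0 := by
  constructor
  · intro h
    have h' : ∀ p : N × Q, (x p.1 + v p.2, z p.2) = (t • p.1, t • p.2) := fun p => by
      rw [← upperBlock_apply, h]; rfl
    refine ⟨?_, ?_, ?_⟩ <;> ext q
    · simpa using congrArg Prod.fst (h' (q, 0))
    · simpa using congrArg Prod.snd (h' (0, q))
    · simpa using congrArg Prod.fst (h' (0, q))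
  · rintro ⟨rfl, rfl, rfl⟩
    apply LinearMap.ext
    intro p
    simp [Prod.ext_iff]

theorem preserves_nested_iff (B : Submodule K Q) (X : End K (N × Q)) :
    ((⊤ : Submodule K N).prod (⊥ : Submodule K Q) ≤ ((⊤ : Submodule K N).prod ⊥).comap X ∧
      (⊤ : Submodule K N).prod B ≤ ((⊤ : Submodule K N).prod B).comap X) ↔
    ∃ (x : End K N) (z : End K Q) (v : Q →ₗ[K] N), B ≤ B.comap z ∧ X = upperBlock x z v := by
  constructor
  · rintro ⟨h1, h2⟩
    refine ⟨LinearMap.fst K N Q ∘ₗ X ∘ₗ LinearMap.inl K N Q,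
      LinearMap.snd K N Q ∘ₗ X ∘ₗ LinearMap.inr K N Q,
      LinearMap.fst K N Q ∘ₗ X ∘ₗ LinearMap.inr K N Q, fun b hb => ?_, ?_⟩
    · have := h2 (show ((0 : N), b) ∈ (⊤ : Submodule K N).prod B from ⟨trivial, hb⟩)
      exact this.2
    · have h0 : ∀ m : N, (X (m, 0)).2 = 0 := fun m => by
        have := h1 (show (m, (0 : Q)) ∈ (⊤ : Submodule K N).prod ⊥ from ⟨trivial, rfl⟩)
        exact this.2
      apply LinearMap.ext
      rintro ⟨m, q⟩
      have : X (m, q) = X (m, 0) + X (0, q) := by rw [← map_add]; simp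
      rw [this]
      simp [Prod.ext_iff, h0]
  · rintro ⟨x, z, v, hz, rfl⟩
    refine ⟨?_, ?_⟩
    · rintro ⟨m, q⟩ ⟨-, hq⟩
      have : q = 0 := hq
      subst this
      exact ⟨trivial, by simp⟩
    · rintro ⟨m, q⟩ ⟨-, hq⟩
      exact ⟨trivial, hz hq⟩

/-- Only the values of a functional on block upper triangular maps matter: it splits into `f` on the
diagonal blocks and, by trace duality, some `φ` pairing with the corner block. -/
theorem isFrobeniusPair_nested_iff_exists_functional (B : Submodule K Q) [FiniteDimensional K N]
    [FiniteDimensional K Q] :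
    IsFrobeniusPair ((⊤ : Submodule K N).prod (⊥ : Submodule K Q)) ((⊤ : Submodule K N).prod B) ↔
      ∃ (f : Dual K (End K N × End K Q)) (φ : N →ₗ[K] Q),
        ∀ (x : End K N) (z : End K Q) (v : Q →ₗ[K] N), B ≤ B.comap z →
          (∀ (x' : End K N) (z' : End K Q) (v' : Q →ₗ[K] N), B ≤ B.comap z' →
            f (x * x' - x' * x, z * z' - z' * z) +
              LinearMap.trace K Q (φ ∘ₗ (x ∘ₗ v' - v' ∘ₗ z)) -
              LinearMap.trace K Q (φ ∘ₗ (x' ∘ₗ v - v ∘ₗ z')) = 0) →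
          ∃ t : K, x = t • 1 ∧ z = t • 1 ∧ v = 0 := by
  have key : ∀ (F : Dual K (End K (N × Q))) (f : Dual K (End K N × End K Q)) (φ : N →ₗ[K] Q),
      (∀ x z v, F (upperBlock x z v) = f (x, z) + LinearMap.trace K Q (φ ∘ₗ v)) →
      ∀ x z v x' z' v', F (upperBlock x z v * upperBlock x' z' v' -
          upperBlock x' z' v' * upperBlock x z v) =
        f (x * x' - x' * x, z * z' - z' * z) +
              LinearMap.trace K Q (φ ∘ₗ (x ∘ₗ v' - v' ∘ₗ z)) -
              LinearMap.trace K Q (φ ∘ₗ (x' ∘ₗ v - v ∘ₗ z')) := by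
    intro F f φ hF x z v x' z' v'
    rw [upperBlock_mul, upperBlock_mul, upperBlock_sub, hF]
    simp only [LinearMap.comp_add, LinearMap.comp_sub, map_add, map_sub]
    ring
  have main : ∀ (F : Dual K (End K (N × Q))) (f : Dual K (End K N × End K Q)) (φ : N →ₗ[K] Q),
      (∀ x z v, F (upperBlock x z v) = f (x, z) + LinearMap.trace K Q (φ ∘ₗ v)) →
      ((∀ X : End K (N × Q), (⊤ : Submodule K N).prod (⊥ : Submodule K Q) ≤
          ((⊤ : Submodule K N).prod ⊥).comap X →
        (⊤ : Submodule K N).prod B ≤ ((⊤ : Submodule K N).prod B).comap X →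
        (∀ Y : End K (N × Q), (⊤ : Submodule K N).prod (⊥ : Submodule K Q) ≤
          ((⊤ : Submodule K N).prod ⊥).comap Y →
          (⊤ : Submodule K N).prod B ≤ ((⊤ : Submodule K N).prod B).comap Y →
          F (X * Y - Y * X) = 0) → ∃ t : K, X = t • 1) ↔
        ∀ (x : End K N) (z : End K Q) (v : Q →ₗ[K] N), B ≤ B.comap z →
          (∀ (x' : End K N) (z' : End K Q) (v' : Q →ₗ[K] N), B ≤ B.comap z' →
            f (x * x' - x' * x, z * z' - z' * z) +
              LinearMap.trace K Q (φ ∘ₗ (x ∘ₗ v' - v' ∘ₗ z)) -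
              LinearMap.trace K Q (φ ∘ₗ (x' ∘ₗ v - v ∘ₗ z')) = 0) →
          ∃ t : K, x = t • 1 ∧ z = t • 1 ∧ v = 0) := by
    intro F f φ hF
    constructor
    · intro h x z v hz hk
      have hX := (preserves_nested_iff B (upperBlock x z v)).2 ⟨x, z, v, hz, rfl⟩
      obtain ⟨t, ht⟩ := h _ hX.1 hX.2 fun Y hY1 hY2 => by
        obtain ⟨x', z', v', hz', rfl⟩ := (preserves_nested_iff B Y).1 ⟨hY1, hY2⟩
        rw [key F f φ hF]
        exact hk x' z' v' hz'
      exact ⟨t, (upperBlock_eq_smul_one_iff x z v t).1 ht⟩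
    · intro h X hX1 hX2 hk
      obtain ⟨x, z, v, hz, rfl⟩ := (preserves_nested_iff B X).1 ⟨hX1, hX2⟩
      obtain ⟨t, ht⟩ := h x z v hz fun x' z' v' hz' => by
        have hY := (preserves_nested_iff B (upperBlock x' z' v')).2 ⟨x', z', v', hz', rfl⟩
        rw [← key F f φ hF]
        exact hk _ hY.1 hY.2
      exact ⟨t, (upperBlock_eq_smul_one_iff x z v t).2 ht⟩
  constructor
  · rintro ⟨F, hF⟩
    let i : (End K N × End K Q) →ₗ[K] End K (N × Q) :=
      { toFun := fun p => upperBlock p.1 p.2 0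
        map_add' := fun p q => by
          apply LinearMap.ext; intro r; simp
        map_smul' := fun t p => by
          apply LinearMap.ext; intro r; simp }
    let j : (Q →ₗ[K] N) →ₗ[K] End K (N × Q) :=
      { toFun := fun v => upperBlock 0 0 v
        map_add' := fun p q => by
          apply LinearMap.ext; intro r; simp
        map_smul' := fun t p => by
          apply LinearMap.ext; intro r; simp }
    obtain ⟨φ, hφ⟩ := exists_forall_apply_eq_trace_comp (F ∘ₗ j)
    refine ⟨F ∘ₗ i, φ, (main F (F ∘ₗ i) φ fun x z v => ?_).1 hF⟩
    rw [← hφ]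
    change F _ = F (upperBlock x z 0) + F (upperBlock 0 0 v)
    rw [← map_add]
    congr 1
    apply LinearMap.ext; intro r; simp
  · rintro ⟨f, φ, h⟩
    let F : Dual K (End K (N × Q)) :=
      { toFun := fun X => f (LinearMap.fst K N Q ∘ₗ X ∘ₗ LinearMap.inl K N Q,
            LinearMap.snd K N Q ∘ₗ X ∘ₗ LinearMap.inr K N Q) +
          LinearMap.trace K Q (φ ∘ₗ LinearMap.fst K N Q ∘ₗ X ∘ₗ LinearMap.inr K N Q)
        map_add' := fun X Y => by
          simp only [LinearMap.add_comp, LinearMap.comp_add, map_add, ← Prod.mk_add_mk]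
          ring
        map_smul' := fun t X => by
          simp only [LinearMap.smul_comp, LinearMap.comp_smul, map_smul, ← Prod.smul_mk,
            RingHom.id_apply, smul_eq_mul]
          ring }
    refine ⟨F, (main F f φ fun x z v => ?_).2 h⟩
    change f _ + LinearMap.trace K Q _ = _
    congr 3
    · ext; simp
    · ext; simp

end Blocks

/-! ### Reduction from a flag to the stabilizer of `φ` -/

section NestedReduction

variable {K N Q : Type*} [Field K] [AddCommGroup N] [Module K N] [AddCommGroup Q] [Module K Q]

/-- Cyclicity of the trace moves the action of `(x, z)` from `v` to `φ`; hence the pairing vanishes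
for all `v` exactly when `(x, z)` stabilizes `φ`. -/
theorem trace_comp_sub_eq [FiniteDimensional K Q] [FiniteDimensional K N] (φ : N →ₗ[K] Q)
    (x : End K N) (z : End K Q) (v : Q →ₗ[K] N) :
    LinearMap.trace K Q (φ ∘ₗ (x ∘ₗ v - v ∘ₗ z)) =
      LinearMap.trace K Q ((φ ∘ₗ x - z ∘ₗ φ) ∘ₗ v) := by
  have : LinearMap.trace K Q ((φ ∘ₗ v) ∘ₗ z) = LinearMap.trace K Q (z ∘ₗ (φ ∘ₗ v)) :=
    LinearMap.trace_comp_comm' _ _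
  rw [LinearMap.comp_sub, LinearMap.sub_comp, map_sub, map_sub, ← LinearMap.comp_assoc,
    ← LinearMap.comp_assoc, this, LinearMap.comp_assoc, LinearMap.comp_assoc]

/-- `φ : N → Q` has an open orbit under `GL(N)` and the stabilizer of `B` in `GL(Q)`. -/
def HasOpenOrbit (B : Submodule K Q) (φ : N →ₗ[K] Q) : Prop :=
  ∀ v : Q →ₗ[K] N, (∀ (x : End K N) (z : End K Q), B ≤ B.comap z →
    LinearMap.trace K Q (φ ∘ₗ (x ∘ₗ v - v ∘ₗ z)) = 0) → v = 0

/-- The stabilizer of `φ : N → Q` in `gl(N)` and the stabilizer of `B` in `gl(Q)` carries a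
functional `f` with only scalars in the kernel of the commutator form. -/
def HasFrobeniusStabilizer (B : Submodule K Q) (φ : N →ₗ[K] Q) : Prop :=
  ∃ f : Dual K (End K N × End K Q), ∀ (x : End K N) (z : End K Q), B ≤ B.comap z →
    φ ∘ₗ x = z ∘ₗ φ →
    (∀ (x' : End K N) (z' : End K Q), B ≤ B.comap z' → φ ∘ₗ x' = z' ∘ₗ φ →
      f (x * x' - x' * x, z * z' - z' * z) = 0) →
    ∃ t : K, x = t • 1 ∧ z = t • 1

/-- This is `semidirect_kernel_iff` with `H = gl(N) × stab(B)`, `V = Hom(Q, N)` and `e = (1, 1)`;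
here `ker D` is the stabilizer of `φ`. -/
theorem isFrobeniusPair_nested_iff [FiniteDimensional K Q] [FiniteDimensional K N]
    (B : Submodule K Q) :
    IsFrobeniusPair ((⊤ : Submodule K N).prod (⊥ : Submodule K Q)) ((⊤ : Submodule K N).prod B) ↔
      ∃ φ : N →ₗ[K] Q, HasOpenOrbit B φ ∧ HasFrobeniusStabilizer B φ := by
  rw [isFrobeniusPair_nested_iff_exists_functional, exists_comm]
  simp only [HasFrobeniusStabilizer, ← exists_and_left]
  refine exists_congr fun φ => exists_congr fun f => ?_
  let H : Submodule K (End K N × End K Q) :=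
    { carrier := {p | B ≤ B.comap p.2}
      zero_mem' := fun b _ => by simp
      add_mem' := fun hp hq b hb => B.add_mem (hp hb) (hq hb)
      smul_mem' := fun t p hp b hb => B.smul_mem t (hp hb) }
  let β : H →ₗ[K] H →ₗ[K] K := LinearMap.mk₂ K
    (fun p q => f (p.1.1 * q.1.1 - q.1.1 * p.1.1, p.1.2 * q.1.2 - q.1.2 * p.1.2))
    (fun p p' q => by
      rw [← map_add]; congr 1
      simp only [Submodule.coe_add, Prod.fst_add, Prod.snd_add, Prod.mk_add_mk, add_mul, mul_add]
      congr 1 <;> abel)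
    (fun t p q => by
      rw [← map_smul]; congr 1
      simp only [Submodule.coe_smul, Prod.smul_fst, Prod.smul_snd, Prod.smul_mk, smul_mul_assoc,
        mul_smul_comm, smul_sub])
    (fun p q q' => by
      rw [← map_add]; congr 1
      simp only [Submodule.coe_add, Prod.fst_add, Prod.snd_add, Prod.mk_add_mk, add_mul, mul_add]
      congr 1 <;> abel)
    (fun t p q => by
      rw [← map_smul]; congr 1
      simp only [Submodule.coe_smul, Prod.smul_fst, Prod.smul_snd, Prod.smul_mk, smul_mul_assoc,
        mul_smul_comm, smul_sub])
  let D : H →ₗ[K] Dual K (Q →ₗ[K] N) := LinearMap.mk₂ K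
    (fun p v => LinearMap.trace K Q (φ ∘ₗ (p.1.1 ∘ₗ v - v ∘ₗ p.1.2)))
    (fun p p' v => by
      rw [← map_add, ← LinearMap.comp_add]; congr 2
      simp only [Submodule.coe_add, Prod.fst_add, Prod.snd_add, LinearMap.add_comp,
        LinearMap.comp_add]
      abel)
    (fun t p v => by
      rw [← map_smul, ← LinearMap.comp_smul]; congr 2
      simp only [Submodule.coe_smul, Prod.smul_fst, Prod.smul_snd, LinearMap.smul_comp,
        LinearMap.comp_smul, smul_sub])
    (fun p v v' => by
      rw [← map_add, ← LinearMap.comp_add]; congr 2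
      simp only [LinearMap.add_comp, LinearMap.comp_add]
      abel)
    (fun t p v => by
      rw [← map_smul, ← LinearMap.comp_smul]; congr 2
      simp only [LinearMap.smul_comp, LinearMap.comp_smul, smul_sub])
  let e : H := ⟨(1, 1), fun b hb => hb⟩
  have hD : ∀ p : H, D p = 0 ↔ φ ∘ₗ p.1.1 = p.1.2 ∘ₗ φ := by
    intro p
    rw [← sub_eq_zero (b := p.1.2 ∘ₗ φ)]
    constructor
    · intro h
      refine eq_zero_of_forall_trace_comp_eq_zero _ fun v => ?_
      rw [← trace_comp_sub_eq]
      exact LinearMap.congr_fun h v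
    · intro h
      apply LinearMap.ext
      intro v
      change LinearMap.trace K Q (φ ∘ₗ (p.1.1 ∘ₗ v - v ∘ₗ p.1.2)) = 0
      rw [trace_comp_sub_eq, h, LinearMap.zero_comp, map_zero]
  have hmain := semidirect_kernel_iff β D e fun p => by
    change f (1 * p.1.1 - p.1.1 * 1, 1 * p.1.2 - p.1.2 * 1) = 0
    simp only [one_mul, mul_one, sub_self]
    exact map_zero f
  have he : ∀ (p : H) (t : K), p = t • e ↔ p.1.1 = t • 1 ∧ p.1.2 = t • 1 := fun p t => by
    rw [Subtype.ext_iff, Prod.ext_iff]; rfl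
  simp only [hD, he] at hmain
  constructor
  · intro h
    obtain ⟨h1, h2⟩ := hmain.1 fun p v hpv => by
      obtain ⟨t, ht1, ht2, ht3⟩ := h p.1.1 p.1.2 v p.2 fun x' z' v' hz' => hpv ⟨(x', z'), hz'⟩ v'
      exact ⟨t, ⟨ht1, ht2⟩, ht3⟩
    exact ⟨fun v hv => h1 v fun p => hv _ _ p.2,
      fun x z hz hxz hk => h2 ⟨(x, z), hz⟩ hxz fun p hp => hk _ _ p.2 hp⟩
  · rintro ⟨h1, h2⟩ x z v hz hk
    obtain ⟨t, ⟨ht1, ht2⟩, ht3⟩ := hmain.2 ⟨fun v hv => h1 v fun x z hz => hv ⟨(x, z), hz⟩,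
      fun p hp hpk => h2 p.1.1 p.1.2 p.2 hp fun x' z' hz' hxz' => hpk ⟨(x', z'), hz'⟩ hxz'⟩
      ⟨(x, z), hz⟩ v fun p v' => hk _ _ v' p.2
    exact ⟨t, ht1, ht2, ht3⟩

theorem HasOpenOrbit.of_surjective [FiniteDimensional K Q] [FiniteDimensional K N]
    (B : Submodule K Q) {φ : N →ₗ[K] Q}
    (hφ : Function.Surjective φ) : HasOpenOrbit B φ := by
  intro v hv
  have h0 : v ∘ₗ φ = 0 := by
    refine eq_zero_of_forall_trace_comp_eq_zero _ fun x => ?_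
    have := hv x 0 fun b _ => by simp
    rw [LinearMap.comp_zero, sub_zero, ← LinearMap.comp_assoc, LinearMap.trace_comp_comm'] at this
    rwa [LinearMap.comp_assoc]
  ext q
  obtain ⟨m, rfl⟩ := hφ q
  exact LinearMap.congr_fun h0 m

theorem trace_comp_smulRight_sub [FiniteDimensional K Q] (φ : N →ₗ[K] Q) (x : End K N)
    (z : End K Q) (ξ : Dual K Q)
    (m : N) : LinearMap.trace K Q (φ ∘ₗ (x ∘ₗ ξ.smulRight m - ξ.smulRight m ∘ₗ z)) =
      ξ (φ (x m)) - ξ (z (φ m)) := by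
  have h1 : φ ∘ₗ (x ∘ₗ ξ.smulRight m) = ξ.smulRight (φ (x m)) := by ext; simp
  have h2 : φ ∘ₗ (ξ.smulRight m ∘ₗ z) = (ξ ∘ₗ z).smulRight (φ m) := by ext; simp
  rw [LinearMap.comp_sub, map_sub, h1, h2, LinearMap.trace_smulRight, LinearMap.trace_smulRight]
  rfl

/-- Rank-one maps `v = ξ ⊗ m` are the test vectors for an open orbit. -/
theorem HasOpenOrbit.eq_zero_of_dual [FiniteDimensional K Q] [FiniteDimensional K N]
    {B : Submodule K Q} {φ : N →ₗ[K] Q} (h : HasOpenOrbit B φ)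
    {ξ : Dual K Q} (hξ : ∀ m, ξ (φ m) = 0) {m : N}
    (hm : ∀ z : End K Q, B ≤ B.comap z → ξ (z (φ m)) = 0) (hm0 : m ≠ 0) : ξ = 0 := by
  have h0 := h (ξ.smulRight m) fun x z hz => by
    rw [trace_comp_smulRight_sub, hξ, hm z hz, sub_zero]
  ext q
  have := LinearMap.congr_fun h0 q
  simpa [hm0] using this

theorem HasOpenOrbit.injective_or_surjective [FiniteDimensional K Q] [FiniteDimensional K N]
    {B : Submodule K Q} {φ : N →ₗ[K] Q}
    (h : HasOpenOrbit B φ) : Function.Injective φ ∨ Function.Surjective φ := by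
  by_contra! hcon
  obtain ⟨h1, h2⟩ := hcon
  rw [injective_iff_map_eq_zero] at h1
  push Not at h1
  obtain ⟨m, hm, hm0⟩ := h1
  rw [← LinearMap.range_eq_top] at h2
  obtain ⟨ξ, hξ0, hξ⟩ := Submodule.exists_dual_map_eq_bot_of_lt_top (lt_top_iff_ne_top.2 h2)
    inferInstance
  refine hξ0 (h.eq_zero_of_dual (fun m' => ?_) (m := m) (fun z _ => by simp [hm]) hm0)
  have : ξ (φ m') ∈ (LinearMap.range φ).map ξ := ⟨_, ⟨m', rfl⟩, rfl⟩
  rwa [hξ] at this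

/-- If `v` is orthogonal to the orbit directions, then `φ ∘ v` kills `range φ ⊔ B` and takes values
in `range φ ⊓ B`, so either alternative makes it zero. If both fail, a rank-one `v` survives. -/
theorem hasOpenOrbit_iff_of_injective [FiniteDimensional K Q] [FiniteDimensional K N]
    (B : Submodule K Q) {φ : N →ₗ[K] Q}
    (hφ : Function.Injective φ) :
    HasOpenOrbit B φ ↔ LinearMap.range φ ⊓ B = ⊥ ∨ LinearMap.range φ ⊔ B = ⊤ := by
  constructor
  · intro h
    by_contra! hcon
    obtain ⟨h1, h2⟩ := hcon
    obtain ⟨c, ⟨⟨m, rfl⟩, hcB⟩, hc0⟩ := Submodule.exists_mem_ne_zero_of_ne_bot h1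
    obtain ⟨ξ, hξ0, hξ⟩ := Submodule.exists_dual_map_eq_bot_of_lt_top (lt_top_iff_ne_top.2 h2)
      inferInstance
    have hξ' : ∀ q ∈ LinearMap.range φ ⊔ B, ξ q = 0 := fun q hq => by
      have : ξ q ∈ (LinearMap.range φ ⊔ B).map ξ := ⟨_, hq, rfl⟩
      rwa [hξ] at this
    refine hξ0 (h.eq_zero_of_dual (fun m' => hξ' _ (Submodule.mem_sup_left ⟨m', rfl⟩)) (m := m)
      (fun z hz => hξ' _ (Submodule.mem_sup_right (hz hcB))) ?_)
    rintro rfl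
    simp at hc0
  · intro h v hv
    have h0 : v ∘ₗ φ = 0 := by
      refine eq_zero_of_forall_trace_comp_eq_zero _ fun x => ?_
      have := hv x 0 fun b _ => by simp
      rw [LinearMap.comp_zero, sub_zero, ← LinearMap.comp_assoc, LinearMap.trace_comp_comm'] at this
      rwa [LinearMap.comp_assoc]
    -- The rank-one map `ξ ⊗ q` preserves `B` when `q ∈ B` or `ξ` kills `B`, so it may be used as
    -- `z`.
    have hrank : ∀ (ξ : Dual K Q) (q : Q), (q ∈ B ∨ ∀ b ∈ B, ξ b = 0) → ξ (φ (v q)) = 0 := by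
      intro ξ q hq
      have := hv 0 (ξ.smulRight q) fun b hb => by
        rcases hq with hq | hq
        · exact B.smul_mem _ hq
        · simp [hq b hb]
      rw [LinearMap.zero_comp, zero_sub, LinearMap.comp_neg, map_neg, neg_eq_zero] at this
      rw [← this, ← LinearMap.trace_smulRight]
      congr 1
      ext
      simp
    have hB : ∀ q ∈ B, φ (v q) = 0 := fun q hq =>
      (Module.forall_dual_apply_eq_zero_iff K _).1 fun ξ => hrank ξ q (Or.inl hq)
    have hQ : ∀ q, φ (v q) ∈ B := fun q => by
      by_contra hcon
      obtain ⟨ξ, hξ, hξB⟩ := Submodule.exists_dual_map_eq_bot_of_notMem hcon inferInstance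
      refine hξ (hrank ξ q (Or.inr fun b hb => ?_))
      have : ξ b ∈ B.map ξ := ⟨_, hb, rfl⟩
      rwa [hξB] at this
    have hzero : ∀ q, φ (v q) = 0 := by
      rcases h with h | h
      · intro q
        have : φ (v q) ∈ LinearMap.range φ ⊓ B := ⟨⟨_, rfl⟩, hQ q⟩
        rwa [h] at this
      · intro q
        obtain ⟨-, ⟨m, rfl⟩, b, hb, rfl⟩ := Submodule.mem_sup.1 (h ▸ Submodule.mem_top : q ∈ _)
        have := LinearMap.congr_fun h0 m
        simp only [LinearMap.comp_apply, LinearMap.zero_apply] at this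
        rw [map_add, map_add, this, map_zero, zero_add, hB b hb]
    ext q
    exact hφ (by simpa using hzero q)

/-- In a stabilizing pair `(x, z)`, `x` is the restriction of `z` to `range φ`; so `z` alone
parametrizes the stabilizer. -/
theorem hasFrobeniusStabilizer_iff_of_injective (B : Submodule K Q) {φ : N →ₗ[K] Q}
    (hφ : Function.Injective φ) :
    HasFrobeniusStabilizer B φ ↔ IsFrobeniusPair (LinearMap.range φ) B := by
  obtain ⟨π, hπ⟩ := φ.exists_leftInverse_of_injective (LinearMap.ker_eq_bot.2 hφ)
  have hπ' : ∀ m, π (φ m) = m := LinearMap.congr_fun hπ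
  have hx : ∀ z : End K Q, LinearMap.range φ ≤ (LinearMap.range φ).comap z →
      φ ∘ₗ (π ∘ₗ z ∘ₗ φ) = z ∘ₗ φ := by
    intro z hz
    ext m
    obtain ⟨m', hm'⟩ := hz ⟨m, rfl⟩
    simp only [LinearMap.comp_apply]
    rw [← hm', hπ']
  have hr : ∀ (x : End K N) (z : End K Q), φ ∘ₗ x = z ∘ₗ φ →
      LinearMap.range φ ≤ (LinearMap.range φ).comap z := by
    rintro x z hxz - ⟨m, rfl⟩
    exact ⟨x m, LinearMap.congr_fun hxz m⟩
  have hu : ∀ (x : End K N) (z : End K Q), φ ∘ₗ x = z ∘ₗ φ → x = π ∘ₗ z ∘ₗ φ := by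
    intro x z hxz
    rw [← hxz, ← LinearMap.comp_assoc, hπ, LinearMap.id_comp]
  constructor
  · rintro ⟨f, hf⟩
    let F : Dual K (End K Q) :=
      { toFun := fun z => f (π ∘ₗ z ∘ₗ φ, z)
        map_add' := fun z z' => by
          rw [← map_add, LinearMap.add_comp, LinearMap.comp_add, Prod.mk_add_mk]
        map_smul' := fun t z => by
          rw [LinearMap.smul_comp, LinearMap.comp_smul, ← Prod.smul_mk, map_smul]; rfl }
    refine ⟨F, fun z hzA hzB hk => ?_⟩
    obtain ⟨t, -, ht⟩ := hf _ z hzB (hx z hzA) fun x' z' hzB' hxz' => by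
      have := hk z' (hr x' z' hxz') hzB'
      rw [← this]
      change _ = f _
      congr 2
      refine hu _ _ ?_
      have e1 := LinearMap.congr_fun (hx z hzA)
      have e2 := LinearMap.congr_fun hxz'
      ext m
      simp only [LinearMap.comp_apply] at e1 e2
      have e3 := e2 (π (z (φ m)))
      rw [e1] at e3
      simp [Module.End.mul_apply, e3, e1, ← e2 m]
    exact ⟨t, ht⟩
  · rintro ⟨F, hF⟩
    refine ⟨F ∘ₗ LinearMap.snd K _ _, fun x z hzB hxz hk => ?_⟩
    obtain ⟨t, rfl⟩ := hF z (hr x z hxz) hzB fun z' hzA' hzB' => hk _ z' hzB' (hx z' hzA')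
    refine ⟨t, ?_, rfl⟩
    rw [hu _ _ hxz]
    ext m
    simp [hπ']

/-- Here `z` is the map that `x` induces on `N / ker φ`, so `x` alone parametrizes the stabilizer.
-/
theorem hasFrobeniusStabilizer_iff_of_surjective (B : Submodule K Q) {φ : N →ₗ[K] Q}
    (hφ : Function.Surjective φ) :
    HasFrobeniusStabilizer B φ ↔ IsFrobeniusPair (LinearMap.ker φ) (B.comap φ) := by
  obtain ⟨s, hs⟩ := φ.exists_rightInverse_of_surjective (LinearMap.range_eq_top.2 hφ)
  have hs' : ∀ q, φ (s q) = q := LinearMap.congr_fun hs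
  have hz : ∀ x : End K N, LinearMap.ker φ ≤ (LinearMap.ker φ).comap x →
      φ ∘ₗ x = (φ ∘ₗ x ∘ₗ s) ∘ₗ φ := by
    intro x hx
    ext m
    have : φ (x (m - s (φ m))) = 0 := hx (by simp [hs'])
    rw [map_sub, map_sub, sub_eq_zero] at this
    exact this
  have hk : ∀ (x : End K N) (z : End K Q), φ ∘ₗ x = z ∘ₗ φ →
      LinearMap.ker φ ≤ (LinearMap.ker φ).comap x := by
    intro x z hxz m hm
    have := LinearMap.congr_fun hxz m
    simp only [LinearMap.comp_apply, LinearMap.mem_ker.1 hm, map_zero] at this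
    exact this
  have hB : ∀ (x : End K N) (z : End K Q), φ ∘ₗ x = z ∘ₗ φ →
      (B ≤ B.comap z ↔ B.comap φ ≤ (B.comap φ).comap x) := by
    intro x z hxz
    have e := LinearMap.congr_fun hxz
    simp only [LinearMap.comp_apply] at e
    constructor
    · intro h m hm
      change φ (x m) ∈ B
      rw [e]
      exact h hm
    · intro h b hb
      have : φ (x (s b)) ∈ B := h (show φ (s b) ∈ B by rwa [hs'])
      rwa [e, hs'] at this
  have hu : ∀ (x : End K N) (z : End K Q), φ ∘ₗ x = z ∘ₗ φ → z = φ ∘ₗ x ∘ₗ s := by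
    intro x z hxz
    rw [← LinearMap.comp_assoc, hxz, LinearMap.comp_assoc, hs, LinearMap.comp_id]
  constructor
  · rintro ⟨f, hf⟩
    let F : Dual K (End K N) :=
      { toFun := fun x => f (x, φ ∘ₗ x ∘ₗ s)
        map_add' := fun z z' => by
          rw [← map_add, LinearMap.add_comp, LinearMap.comp_add, Prod.mk_add_mk]
        map_smul' := fun t z => by
          rw [LinearMap.smul_comp, LinearMap.comp_smul, ← Prod.smul_mk, map_smul]; rfl }
    refine ⟨F, fun x hxk hxB hxy => ?_⟩
    obtain ⟨t, ht, -⟩ := hf x _ ((hB _ _ (hz x hxk)).2 hxB) (hz x hxk) fun x' z' hzB' hxz' => by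
      rw [← hxy x' (hk _ _ hxz') ((hB _ _ hxz').1 hzB')]
      change _ = f _
      congr 2
      refine hu _ _ ?_
      have e1 := LinearMap.congr_fun (hz x hxk)
      have e2 := LinearMap.congr_fun hxz'
      ext m
      simp only [LinearMap.comp_apply] at e1 e2
      simp [Module.End.mul_apply, ← e1, ← e2]
    exact ⟨t, ht⟩
  · rintro ⟨F, hF⟩
    refine ⟨F ∘ₗ LinearMap.fst K _ _, fun x z hzB hxz hxy => ?_⟩
    obtain ⟨t, rfl⟩ := hF x (hk x z hxz) ((hB _ _ hxz).1 hzB) fun x' hxk' hxB' =>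
      hxy x' _ ((hB _ _ (hz x' hxk')).2 hxB') (hz x' hxk')
    refine ⟨t, rfl, ?_⟩
    rw [hu _ _ hxz]
    ext q
    simp [hs']

theorem isFrobeniusPair_nested_iff_of_finrank_le [FiniteDimensional K Q] [FiniteDimensional K N]
    (B : Submodule K Q)
    (hNQ : finrank K N ≤ finrank K Q) :
    IsFrobeniusPair ((⊤ : Submodule K N).prod (⊥ : Submodule K Q)) ((⊤ : Submodule K N).prod B) ↔
      ∃ A : Submodule K Q, finrank K A = finrank K N ∧ (A ⊓ B = ⊥ ∨ A ⊔ B = ⊤) ∧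
        IsFrobeniusPair A B := by
  rw [isFrobeniusPair_nested_iff]
  constructor
  · rintro ⟨φ, h1, h2⟩
    have hφ : Function.Injective φ := by
      rcases h1.injective_or_surjective with h | h
      · exact h
      · have := LinearMap.finrank_le_finrank_of_surjective h
        exact (LinearMap.injective_iff_surjective_of_finrank_eq_finrank (hNQ.antisymm this)).2 h
    exact ⟨LinearMap.range φ, LinearMap.finrank_range_of_inj hφ,
      (hasOpenOrbit_iff_of_injective B hφ).1 h1, (hasFrobeniusStabilizer_iff_of_injective B hφ).1 h2⟩
  · rintro ⟨A, hA, hAB, hF⟩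
    let e : N ≃ₗ[K] A := LinearEquiv.ofFinrankEq N A hA.symm
    let φ : N →ₗ[K] Q := A.subtype ∘ₗ e.toLinearMap
    have hφ : Function.Injective φ := A.injective_subtype.comp e.injective
    have hr : LinearMap.range φ = A := by
      rw [LinearMap.range_comp, LinearEquiv.range, Submodule.map_top, Submodule.range_subtype]
    refine ⟨φ, (hasOpenOrbit_iff_of_injective B hφ).2 ?_,
      (hasFrobeniusStabilizer_iff_of_injective B hφ).2 ?_⟩ <;> rwa [hr]

theorem isFrobeniusPair_nested_iff_of_finrank_ge [FiniteDimensional K Q] [FiniteDimensional K N]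
    (B : Submodule K Q)
    (hNQ : finrank K Q ≤ finrank K N) :
    IsFrobeniusPair ((⊤ : Submodule K N).prod (⊥ : Submodule K Q)) ((⊤ : Submodule K N).prod B) ↔
      ∃ φ : N →ₗ[K] Q, Function.Surjective φ ∧
        IsFrobeniusPair (LinearMap.ker φ) (B.comap φ) := by
  rw [isFrobeniusPair_nested_iff]
  constructor
  · rintro ⟨φ, h1, h2⟩
    have hφ : Function.Surjective φ := by
      rcases h1.injective_or_surjective with h | h
      · have := LinearMap.finrank_le_finrank_of_injective h
        exact (LinearMap.injective_iff_surjective_of_finrank_eq_finrank (this.antisymm hNQ)).1 h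
      · exact h
    exact ⟨φ, hφ, (hasFrobeniusStabilizer_iff_of_surjective B hφ).1 h2⟩
  · rintro ⟨φ, hφ, hF⟩
    exact ⟨φ, .of_surjective B hφ, (hasFrobeniusStabilizer_iff_of_surjective B hφ).2 hF⟩

end NestedReduction

/-! ### Transport along isomorphisms and duality -/

section Transport

variable {K V V' : Type*} [Field K] [AddCommGroup V] [Module K V] [AddCommGroup V'] [Module K V']

theorem IsFrobeniusPair.map_equiv {U W : Submodule K V} (h : IsFrobeniusPair U W)
    (e : V ≃ₗ[K] V') : IsFrobeniusPair (U.map e.toLinearMap) (W.map e.toLinearMap) := by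
  obtain ⟨F, hF⟩ := h
  have hpres : ∀ (S : Submodule K V) (y : End K V'),
      S.map e.toLinearMap ≤ (S.map e.toLinearMap).comap y → S ≤ S.comap (e.symm.conj y) := by
    intro S y hy s hs
    obtain ⟨s', hs', h⟩ := hy ⟨s, hs, rfl⟩
    have h' : e s' = y (e s) := h
    simpa [LinearEquiv.conj_apply, ← h'] using hs'
  have hpres' : ∀ (S : Submodule K V) (x : End K V), S ≤ S.comap x →
      S.map e.toLinearMap ≤ (S.map e.toLinearMap).comap (e.conj x) := by
    rintro S x hx - ⟨s, hs, rfl⟩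
    exact ⟨x s, hx hs, by simp [LinearEquiv.conj_apply]⟩
  refine ⟨F ∘ₗ e.symm.conj.toLinearMap, fun y hU hW hk => ?_⟩
  obtain ⟨t, ht⟩ := hF (e.symm.conj y) (hpres U y hU) (hpres W y hW) fun x hxU hxW => by
    rw [← hk (e.conj x) (hpres' U x hxU) (hpres' W x hxW)]
    change _ = F _
    congr 1
    ext v
    simp [LinearEquiv.conj_apply]
  refine ⟨t, ?_⟩
  ext v
  have := LinearMap.congr_fun ht (e.symm v)
  simp only [LinearEquiv.conj_apply, LinearMap.comp_apply, LinearEquiv.coe_coe,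
    LinearEquiv.symm_symm, LinearEquiv.apply_symm_apply, LinearMap.smul_apply,
    Module.End.one_apply, ← map_smul] at this
  simpa using e.symm.injective this

theorem IsFrobeniusPair.dualAnnihilator [FiniteDimensional K V] {U W : Submodule K V}
    (h : IsFrobeniusPair U W) : IsFrobeniusPair U.dualAnnihilator W.dualAnnihilator := by
  obtain ⟨F, hF⟩ := h
  let τ : End K (Dual K V) →ₗ[K] End K V :=
    { toFun := fun y => (evalEquiv K V).symm.toLinearMap ∘ₗ y.dualMap ∘ₗ (evalEquiv K V).toLinearMap
      map_add' := fun y y' => by ext v; simp [LinearMap.dualMap]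
      map_smul' := fun t y => by ext v; simp [LinearMap.dualMap] }
  have hτ : ∀ (y : End K (Dual K V)) (ξ : Dual K V) (v : V), ξ (τ y v) = y ξ v := by
    intro y ξ v
    change ξ ((evalEquiv K V).symm (y.dualMap (evalEquiv K V v))) = _
    rw [apply_evalEquiv_symm_apply]
    rfl
  have ext' : ∀ v v' : V, (∀ ξ : Dual K V, ξ v = ξ v') → v = v' := fun v v' hv => by
    rw [← sub_eq_zero, ← Module.forall_dual_apply_eq_zero_iff K]
    intro ξ
    rw [map_sub, hv, sub_self]
  have hpres : ∀ (S : Submodule K V) (y : End K (Dual K V)),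
      S.dualAnnihilator ≤ S.dualAnnihilator.comap y → S ≤ S.comap (τ y) := by
    intro S y hy s hs
    rw [Submodule.mem_comap, ← Subspace.forall_mem_dualAnnihilator_apply_eq_zero_iff]
    intro ξ hξ
    rw [hτ]
    exact (Submodule.mem_dualAnnihilator _).1 (hy hξ) s hs
  have hpres' : ∀ (S : Submodule K V) (x : End K V), S ≤ S.comap x →
      S.dualAnnihilator ≤ S.dualAnnihilator.comap x.dualMap := by
    intro S x hx ξ hξ
    rw [Submodule.mem_comap, Submodule.mem_dualAnnihilator]
    intro s hs
    exact (Submodule.mem_dualAnnihilator _).1 hξ _ (hx hs)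
  refine ⟨F ∘ₗ τ, fun y hU hW hk => ?_⟩
  obtain ⟨t, ht⟩ := hF (τ y) (hpres U y hU) (hpres W y hW) fun x hxU hxW => by
    have := hk x.dualMap (hpres' U x hxU) (hpres' W x hxW)
    -- Transposition reverses products, so commutators change sign.
    rw [← neg_eq_zero, ← map_neg, neg_sub, ← this]
    change F _ = F _
    congr 1
    apply LinearMap.ext
    intro v
    refine ext' _ _ fun ξ => ?_
    rw [hτ]
    simp only [LinearMap.sub_apply, Module.End.mul_apply, map_sub, hτ]
    congr 1
    exact hτ y (x.dualMap ξ) v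
  refine ⟨t, ?_⟩
  ext ξ v
  rw [← hτ, ht]
  simp

end Transport

/-! ### Classification of pairs of subspaces by dimensions -/

section Model

variable {K V : Type*} [Field K] [AddCommGroup V] [Module K V] [FiniteDimensional K V]

theorem finrank_submodule_prod {V' : Type*} [AddCommGroup V'] [Module K V']
    [FiniteDimensional K V'] (S : Submodule K V) (S' : Submodule K V') :
    finrank K (S.prod S') = finrank K S + finrank K S' := by
  have hr : LinearMap.range (S.subtype.prodMap S'.subtype) = S.prod S' := by
    rw [LinearMap.range_prodMap, Submodule.range_subtype, Submodule.range_subtype]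
  rw [← hr, LinearMap.finrank_range_of_inj, finrank_prod]
  exact S.injective_subtype.prodMap S'.injective_subtype

theorem exists_relative_complement (X U : Submodule K V) (h : X ≤ U) :
    ∃ C : Submodule K V, X ⊔ C = U ∧ finrank K C + finrank K X = finrank K U := by
  obtain ⟨C, hC⟩ := X.exists_isCompl
  have hsup : X ⊔ (U ⊓ C) = U := by
    rw [inf_comm, ← sup_inf_assoc_of_le C h, hC.sup_eq_top, top_inf_eq]
  have hinf : X ⊓ (U ⊓ C) = ⊥ := by
    rw [inf_left_comm, hC.inf_eq_bot, inf_bot_eq]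
  refine ⟨U ⊓ C, hsup, ?_⟩
  have := Submodule.finrank_sup_add_finrank_inf_eq X (U ⊓ C)
  rw [hsup, hinf, finrank_bot] at this
  omega

/-- A pair of subspaces is determined up to isomorphism by its dimensions. -/
theorem exists_model_equiv (U W : Submodule K V) (i p r z : ℕ)
    (hi : finrank K (U ⊓ W : Submodule K V) = i) (hU : finrank K U = i + p)
    (hW : finrank K W = i + r) (hV : finrank K V = i + p + r + z) :
    ∃ e : ((Fin i → K) × (Fin p → K) × (Fin r → K) × (Fin z → K)) ≃ₗ[K] V,
      ((⊤ : Submodule K (Fin i → K)).prod ((⊤ : Submodule K (Fin p → K)).prod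
        ((⊥ : Submodule K (Fin r → K)).prod (⊥ : Submodule K (Fin z → K))))).map e.toLinearMap = U ∧
      ((⊤ : Submodule K (Fin i → K)).prod ((⊥ : Submodule K (Fin p → K)).prod
        ((⊤ : Submodule K (Fin r → K)).prod (⊥ : Submodule K (Fin z → K))))).map e.toLinearMap = W
      := by
  obtain ⟨C, hC, hCf⟩ := exists_relative_complement (U ⊓ W) U inf_le_left
  obtain ⟨D, hD, hDf⟩ := exists_relative_complement (U ⊓ W) W inf_le_right
  obtain ⟨Z, hZ, hZf⟩ := exists_relative_complement (U ⊔ W) ⊤ le_top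
  have hsum := Submodule.finrank_sup_add_finrank_inf_eq U W
  rw [finrank_top] at hZf
  let eX : (Fin i → K) ≃ₗ[K] (U ⊓ W : Submodule K V) := LinearEquiv.ofFinrankEq _ _ (by simp [hi])
  let eC : (Fin p → K) ≃ₗ[K] C := LinearEquiv.ofFinrankEq _ _ (by simp; omega)
  let eD : (Fin r → K) ≃ₗ[K] D := LinearEquiv.ofFinrankEq _ _ (by simp; omega)
  let eZ : (Fin z → K) ≃ₗ[K] Z := LinearEquiv.ofFinrankEq _ _ (by simp; omega)
  let Φ : ((Fin i → K) × (Fin p → K) × (Fin r → K) × (Fin z → K)) →ₗ[K] V :=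
    ((U ⊓ W).subtype ∘ₗ eX.toLinearMap).coprod ((C.subtype ∘ₗ eC.toLinearMap).coprod
      ((D.subtype ∘ₗ eD.toLinearMap).coprod (Z.subtype ∘ₗ eZ.toLinearMap)))
  have hΦ : ∀ x c d w, Φ (x, c, d, w) = (eX x : V) + ((eC c : V) + ((eD d : V) + (eZ w : V))) :=
    fun _ _ _ _ => rfl
  have hUmem : ∀ u ∈ U, ∃ x c, Φ (x, c, 0, 0) = u := by
    intro u hu
    rw [← hC] at hu
    obtain ⟨x, hx, c, hc, rfl⟩ := Submodule.mem_sup.1 hu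
    exact ⟨eX.symm ⟨x, hx⟩, eC.symm ⟨c, hc⟩, by simp [hΦ]⟩
  have hWmem : ∀ u ∈ W, ∃ x d, Φ (x, 0, d, 0) = u := by
    intro u hu
    rw [← hD] at hu
    obtain ⟨x, hx, c, hc, rfl⟩ := Submodule.mem_sup.1 hu
    exact ⟨eX.symm ⟨x, hx⟩, eD.symm ⟨c, hc⟩, by simp [hΦ]⟩
  have hsurj : Function.Surjective Φ := by
    intro v
    obtain ⟨y, hy, w, hw, rfl⟩ := Submodule.mem_sup.1 (hZ ▸ Submodule.mem_top : v ∈ _)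
    obtain ⟨u, hu, w', hw', rfl⟩ := Submodule.mem_sup.1 hy
    obtain ⟨x, c, rfl⟩ := hUmem u hu
    obtain ⟨x', d, rfl⟩ := hWmem w' hw'
    refine ⟨(x + x', c, d, eZ.symm ⟨w, hw⟩), ?_⟩
    simp only [hΦ, map_add, map_zero, Submodule.coe_add, Submodule.coe_zero,
      LinearEquiv.apply_symm_apply]
    abel
  have hdim : finrank K ((Fin i → K) × (Fin p → K) × (Fin r → K) × (Fin z → K)) = finrank K V := by
    simp only [finrank_prod, finrank_fin_fun]
    omega
  let e := LinearEquiv.ofBijective Φ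
    ⟨(LinearMap.injective_iff_surjective_of_finrank_eq_finrank hdim).2 hsurj, hsurj⟩
  have hCU : C ≤ U := hC ▸ le_sup_right
  have hDW : D ≤ W := hD ▸ le_sup_right
  refine ⟨e, ?_, ?_⟩
  · apply le_antisymm
    · rintro - ⟨⟨x, c, d, w⟩, ⟨-, -, hd, hw⟩, rfl⟩
      have hd : d = 0 := hd
      have hw : w = 0 := hw
      subst hd hw
      change Φ _ ∈ U
      rw [hΦ]
      simpa using U.add_mem (eX x).2.1 (hCU (eC c).2)
    · intro u hu
      obtain ⟨x, c, rfl⟩ := hUmem u hu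
      exact ⟨(x, c, 0, 0), by simp, rfl⟩
  · apply le_antisymm
    · rintro - ⟨⟨x, c, d, w⟩, ⟨-, hc, -, hw⟩, rfl⟩
      have hc : c = 0 := hc
      have hw : w = 0 := hw
      subst hc hw
      change Φ _ ∈ W
      rw [hΦ]
      simpa using W.add_mem (eX x).2.2 (hDW (eD d).2)
    · intro u hu
      obtain ⟨x, c, rfl⟩ := hWmem u hu
      exact ⟨(x, 0, c, 0), by simp, rfl⟩

theorem IsFrobeniusPair.of_finrank_eq {V' : Type*} [AddCommGroup V'] [Module K V']
    [FiniteDimensional K V'] {U W : Submodule K V} {U' W' : Submodule K V'}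
    (h : IsFrobeniusPair U W) (hV : finrank K V = finrank K V') (hU : finrank K U = finrank K U')
    (hW : finrank K W = finrank K W')
    (hi : finrank K (U ⊓ W : Submodule K V) = finrank K (U' ⊓ W' : Submodule K V')) :
    IsFrobeniusPair U' W' := by
  have h1 := Submodule.finrank_sup_add_finrank_inf_eq U W
  have h2 := Submodule.finrank_le (U ⊔ W)
  have h3 := Submodule.finrank_mono (inf_le_left : U ⊓ W ≤ U)
  have h4 := Submodule.finrank_mono (inf_le_right : U ⊓ W ≤ W)
  obtain ⟨p, hp⟩ := Nat.exists_eq_add_of_le h3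
  obtain ⟨r, hr⟩ := Nat.exists_eq_add_of_le h4
  obtain ⟨z, hz⟩ := Nat.exists_eq_add_of_le h2
  obtain ⟨e, heU, heW⟩ := exists_model_equiv U W _ p r z rfl hp hr (by omega)
  obtain ⟨e', heU', heW'⟩ := exists_model_equiv U' W' _ p r z hi.symm (by omega) (by omega)
    (by omega)
  have := (h.map_equiv e.symm).map_equiv e'
  have hsymm : ∀ (S : Submodule K ((Fin _ → K) × (Fin p → K) × (Fin r → K) × (Fin z → K)))
      (T : Submodule K V), S.map e.toLinearMap = T → T.map e.symm.toLinearMap = S := by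
    rintro S T rfl
    rw [← Submodule.map_comp]
    simp
  rwa [hsymm _ _ heU, hsymm _ _ heW, heU', heW'] at this

end Model

/-! ### Moves on dimension types and the Euclidean algorithm -/

section Numerical

variable (K : Type*) [Field K]

/-- Some (equivalently, every) pair of subspaces of dimensions `u` and `w` in a space of
dimension `n`, with intersection of dimension `i`, is a Frobenius pair. -/
def IsFrobeniusType (n u w i : ℕ) : Prop :=
  ∃ U W : Submodule K (Fin n → K), finrank K U = u ∧ finrank K W = w ∧
    finrank K (U ⊓ W : Submodule K (Fin n → K)) = i ∧ IsFrobeniusPair U W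

variable {K}

theorem isFrobeniusPair_iff_isFrobeniusType {V : Type*} [AddCommGroup V] [Module K V]
    [FiniteDimensional K V] {U W : Submodule K V} {n u w i : ℕ} (hn : finrank K V = n)
    (hu : finrank K U = u) (hw : finrank K W = w)
    (hi : finrank K (U ⊓ W : Submodule K V) = i) :
    IsFrobeniusPair U W ↔ IsFrobeniusType K n u w i := by
  constructor
  · intro h
    let e : V ≃ₗ[K] (Fin n → K) := LinearEquiv.ofFinrankEq _ _ (by simp [hn])
    refine ⟨U.map e.toLinearMap, W.map e.toLinearMap, ?_, ?_, ?_, h.map_equiv e⟩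
    · rw [LinearEquiv.finrank_map_eq e, hu]
    · rw [LinearEquiv.finrank_map_eq e, hw]
    · rw [← Submodule.map_inf _ e.injective, LinearEquiv.finrank_map_eq e, hi]
  · rintro ⟨U', W', hu', hw', hi', h⟩
    exact h.of_finrank_eq (by simp [hn]) (by omega) (by omega) (by omega)

theorem isFrobeniusType_comm (n u w i : ℕ) :
    IsFrobeniusType K n u w i ↔ IsFrobeniusType K n w u i := by
  constructor <;> rintro ⟨U, W, hu, hw, hi, h⟩ <;>
    exact ⟨W, U, hw, hu, by rwa [inf_comm], (isFrobeniusPair_comm _ _).1 h⟩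

/-- The annihilators meet in the annihilator of `U ⊔ W`, of dimension `n - (u + w - i)`. -/
theorem IsFrobeniusType.dual {n u w i : ℕ} (h : IsFrobeniusType K n u w i) :
    IsFrobeniusType K n (n - u) (n - w) (n + i - (u + w)) := by
  obtain ⟨U, W, hu, hw, hi, h⟩ := h
  have h1 := Subspace.finrank_add_finrank_dualAnnihilator_eq U
  have h2 := Subspace.finrank_add_finrank_dualAnnihilator_eq W
  have h3 := Subspace.finrank_add_finrank_dualAnnihilator_eq (U ⊔ W)
  have h4 := Submodule.finrank_sup_add_finrank_inf_eq U W
  rw [finrank_fin_fun] at h1 h2 h3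
  refine (isFrobeniusPair_iff_isFrobeniusType ?_ ?_ ?_ ?_).1 h.dualAnnihilator
  · rw [Subspace.dual_finrank_eq, finrank_fin_fun]
  · omega
  · omega
  · rw [← Submodule.dualAnnihilator_sup_eq]
    omega

variable (K) in
/-- The flag type with blocks of sizes `A`, `B`, `C` is Frobenius. -/
def IsFrobeniusFlag (A B C : ℕ) : Prop := IsFrobeniusType K (A + B + C) A (A + B) A

theorem IsFrobeniusFlag.reverse {A B C : ℕ} (h : IsFrobeniusFlag K A B C) :
    IsFrobeniusFlag K C B A := by
  have h' := (isFrobeniusType_comm _ _ _ _).1 (IsFrobeniusType.dual h)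
  unfold IsFrobeniusFlag
  convert h' using 1 <;> omega

theorem isFrobeniusFlag_reverse (A B C : ℕ) :
    IsFrobeniusFlag K A B C ↔ IsFrobeniusFlag K C B A :=
  ⟨.reverse, .reverse⟩

theorem finrank_top_prod_bot (B C : ℕ) :
    finrank K ((⊤ : Submodule K (Fin B → K)).prod (⊥ : Submodule K (Fin C → K))) = B := by
  rw [finrank_submodule_prod]; simp

/-- Both flags amount to a single subspace of dimension `B`. -/
theorem isFrobeniusFlag_zero_left (B C : ℕ) :
    IsFrobeniusFlag K 0 B C ↔ IsFrobeniusFlag K B 0 C := by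
  have hB := finrank_top_prod_bot (K := K) B C
  have h1 := isFrobeniusPair_iff_isFrobeniusType (n := 0 + B + C) (u := 0) (w := 0 + B) (i := 0)
    (U := (⊥ : Submodule K ((Fin B → K) × (Fin C → K))))
    (W := (⊤ : Submodule K (Fin B → K)).prod (⊥ : Submodule K (Fin C → K)))
    (by simp) (by simp) (by omega) (by simp)
  have h2 := isFrobeniusPair_iff_isFrobeniusType (n := B + 0 + C) (u := B) (w := B + 0) (i := B)
    (U := (⊤ : Submodule K (Fin B → K)).prod (⊥ : Submodule K (Fin C → K)))
    (W := (⊤ : Submodule K (Fin B → K)).prod (⊥ : Submodule K (Fin C → K)))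
    (by simp) hB hB (by rw [inf_idem, hB])
  exact h1.symm.trans ((isFrobeniusPair_bot_left _).trans h2)

theorem isFrobeniusPair_nested_iff_isFrobeniusFlag {N Q : Type*} [AddCommGroup N] [Module K N]
    [AddCommGroup Q] [Module K Q] [FiniteDimensional K N] [FiniteDimensional K Q]
    {S : Submodule K Q} {A B C : ℕ} (hN : finrank K N = A) (hQ : finrank K Q = B + C)
    (hS : finrank K S = B) :
    IsFrobeniusPair ((⊤ : Submodule K N).prod (⊥ : Submodule K Q)) ((⊤ : Submodule K N).prod S) ↔
      IsFrobeniusFlag K A B C := by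
  refine isFrobeniusPair_iff_isFrobeniusType ?_ ?_ ?_ ?_
  · rw [finrank_prod]; omega
  · rw [finrank_submodule_prod, finrank_top, finrank_bot, hN]; rfl
  · rw [finrank_submodule_prod, finrank_top, hN, hS]
  · rw [Submodule.prod_inf_prod, inf_idem, bot_inf_eq, finrank_submodule_prod, finrank_top,
      finrank_bot, hN]; rfl

/-- A flag type whose first block is not too large is Frobenius if and only if the corresponding
pair of subspaces in general position is. -/
theorem isFrobeniusFlag_iff_isFrobeniusType {A B C : ℕ} (h : A ≤ B + C) :
    IsFrobeniusFlag K A B C ↔ IsFrobeniusType K (B + C) A B (A - C) := by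
  constructor
  · intro hF
    rw [← isFrobeniusPair_nested_iff_isFrobeniusFlag (N := Fin A → K)
      (Q := (Fin B → K) × (Fin C → K)) (by simp) (by simp) (finrank_top_prod_bot B C),
      isFrobeniusPair_nested_iff_of_finrank_le _ (by simpa using h)] at hF
    obtain ⟨S, hS, hgen, hF⟩ := hF
    have hsum := Submodule.finrank_sup_add_finrank_inf_eq S
      ((⊤ : Submodule K (Fin B → K)).prod (⊥ : Submodule K (Fin C → K)))
    have hle := Submodule.finrank_le (S ⊔
      ((⊤ : Submodule K (Fin B → K)).prod (⊥ : Submodule K (Fin C → K))))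
    rw [finrank_fin_fun] at hS
    rw [hS, finrank_top_prod_bot] at hsum
    rw [finrank_prod, finrank_fin_fun, finrank_fin_fun] at hle
    refine (isFrobeniusPair_iff_isFrobeniusType (by simp) hS (finrank_top_prod_bot B C) ?_).1 hF
    -- Truncated `A - C` is the generic intersection dimension: zero if the subspaces are disjoint,
    -- and `A + B - (B + C)` if they span.
    rcases hgen with hgen | hgen
    · rw [hgen, finrank_bot] at hsum ⊢
      omega
    · rw [hgen, finrank_top, finrank_prod, finrank_fin_fun, finrank_fin_fun] at hsum
      omega
  · rintro ⟨U, W, hU, hW, hi, hF⟩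
    rw [← isFrobeniusPair_nested_iff_isFrobeniusFlag (N := Fin A → K) (by simp) (by simp) hW,
      isFrobeniusPair_nested_iff_of_finrank_le _ (by simpa using h)]
    refine ⟨U, by simp [hU], ?_, hF⟩
    have hsum := Submodule.finrank_sup_add_finrank_inf_eq U W
    rcases le_total A C with hAC | hAC
    · left
      rw [← Submodule.finrank_eq_zero (R := K)]
      omega
    · right
      apply Submodule.eq_top_of_finrank_eq
      rw [finrank_fin_fun]
      omega

theorem finrank_comap_of_surjective {N Q : Type*} [AddCommGroup N] [Module K N]
    [AddCommGroup Q] [Module K Q] [FiniteDimensional K N] (φ : N →ₗ[K] Q)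
    (hφ : Function.Surjective φ) (S : Submodule K Q) :
    finrank K (S.comap φ) = finrank K S + finrank K (LinearMap.ker φ) := by
  have h := LinearMap.finrank_range_add_finrank_ker (φ.domRestrict (S.comap φ))
  rw [LinearMap.range_domRestrict, Submodule.map_comap_eq_of_surjective hφ,
    LinearMap.ker_domRestrict] at h
  have hle : LinearMap.ker φ ≤ S.comap φ := fun x hx => by
    rw [Submodule.mem_comap, LinearMap.mem_ker.1 hx]
    exact S.zero_mem
  rw [← h, (Submodule.comapSubtypeEquivOfLe hle).finrank_eq]

/-- The map `φ` is surjective with kernel of dimension `A`, and `ker φ` lies in the preimage of the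
`B`-block: a flag with blocks `A`, `B`, `C` inside `N`. -/
theorem isFrobeniusFlag_add_left (A B C : ℕ) :
    IsFrobeniusFlag K (A + (B + C)) B C ↔ IsFrobeniusFlag K A B C := by
  rw [← isFrobeniusPair_nested_iff_isFrobeniusFlag (N := (Fin A → K) × (Fin B → K) × (Fin C → K))
      (Q := (Fin B → K) × (Fin C → K)) (by simp) (by simp) (finrank_top_prod_bot B C),
      isFrobeniusPair_nested_iff_of_finrank_ge _ (by simp)]
  have key : ∀ φ : ((Fin A → K) × (Fin B → K) × (Fin C → K)) →ₗ[K] (Fin B → K) × (Fin C → K),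
      Function.Surjective φ → (IsFrobeniusPair (LinearMap.ker φ)
        (((⊤ : Submodule K (Fin B → K)).prod (⊥ : Submodule K (Fin C → K))).comap φ) ↔
          IsFrobeniusFlag K A B C) := by
    intro φ hφ
    have hker : finrank K (LinearMap.ker φ) = A := by
      have := LinearMap.finrank_range_add_finrank_ker φ
      rw [LinearMap.range_eq_top.2 hφ, finrank_top] at this
      simp only [finrank_prod, finrank_fin_fun] at this
      omega
    have hle : LinearMap.ker φ ≤
        ((⊤ : Submodule K (Fin B → K)).prod (⊥ : Submodule K (Fin C → K))).comap φ := fun x hx => by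
      rw [Submodule.mem_comap, LinearMap.mem_ker.1 hx]
      exact Submodule.zero_mem _
    refine isFrobeniusPair_iff_isFrobeniusType (by simp [add_assoc]) hker ?_ ?_
    · rw [finrank_comap_of_surjective φ hφ, hker, finrank_top_prod_bot, add_comm]
    · rw [inf_eq_left.2 hle, hker]
  constructor
  · rintro ⟨φ, hφ, hF⟩
    exact (key φ hφ).1 hF
  · intro hF
    exact ⟨LinearMap.snd K _ _, Prod.snd_surjective, (key _ Prod.snd_surjective).2 hF⟩

/-- Both flags reduce to generic subspaces of dimensions `A` and `B` in a space of dimension `B + C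
= A + D`. -/
theorem isFrobeniusFlag_swap {A B C D : ℕ} (h : A + D = B + C) :
    IsFrobeniusFlag K A B C ↔ IsFrobeniusFlag K B A D := by
  rw [isFrobeniusFlag_iff_isFrobeniusType (by omega), isFrobeniusFlag_iff_isFrobeniusType (by omega),
    isFrobeniusType_comm, h, show A - C = B - D by omega]

/-- The associated generic pair is complementary, and the projection onto one summand along the
other is a nonscalar central element of the stabilizer. -/
theorem not_isFrobeniusFlag_of_pos {A B : ℕ} (hA : 0 < A) (hB : 0 < B) :
    ¬ IsFrobeniusFlag K A B A := by
  rw [isFrobeniusFlag_iff_isFrobeniusType (by omega), Nat.sub_self]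
  rintro ⟨U, W, hU, hW, hi, F, hF⟩
  have hcompl : IsCompl U W := by
    have hsum := Submodule.finrank_sup_add_finrank_inf_eq U W
    refine ⟨disjoint_iff.2 (Submodule.finrank_eq_zero.1 hi), codisjoint_iff.2 ?_⟩
    apply Submodule.eq_top_of_finrank_eq
    rw [finrank_fin_fun]
    omega
  let x : End K (Fin (B + A) → K) := U.subtype ∘ₗ U.projectionOnto W hcompl
  have hxU : ∀ u ∈ U, x u = u := fun u hu => by
    simp [x, Submodule.projectionOnto_apply_left hcompl ⟨u, hu⟩]
  have hxW : ∀ w ∈ W, x w = 0 := fun w hw => by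
    simp [x, (Submodule.projectionOnto_apply_eq_zero_iff hcompl).2 hw]
  obtain ⟨t, ht⟩ := hF x (fun u hu => by rwa [Submodule.mem_comap, hxU u hu])
    (fun w hw => by rw [Submodule.mem_comap, hxW w hw]; exact W.zero_mem) fun y hyU hyW => by
      have : x * y - y * x = 0 := by
        apply LinearMap.ext
        intro v
        obtain ⟨u, hu, w, hw, rfl⟩ :=
          Submodule.mem_sup.1 (hcompl.sup_eq_top ▸ Submodule.mem_top : v ∈ U ⊔ W)
        simp [hxU u hu, hxW w hw, hxU _ (hyU hu), hxW _ (hyW hw)]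
      rw [this, map_zero]
  obtain ⟨u, hu, hu0⟩ := Submodule.exists_mem_ne_zero_of_ne_bot
    (show U ≠ ⊥ by rintro rfl; simp at hU; omega)
  obtain ⟨w, hw, hw0⟩ := Submodule.exists_mem_ne_zero_of_ne_bot
    (show W ≠ ⊥ by rintro rfl; simp at hW; omega)
  have h1 := hxU u hu
  have h2 := hxW w hw
  rw [ht] at h1 h2
  have ht0 : t = 0 := by simpa [hw0] using h2
  subst ht0
  simp [eq_comm, hu0] at h1

theorem isFrobeniusFlag_zero_zero_iff {A : ℕ} (hA : 0 < A) :
    IsFrobeniusFlag K A 0 0 ↔ A = 1 := by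
  rw [isFrobeniusFlag_reverse, IsFrobeniusFlag,
    ← isFrobeniusPair_iff_isFrobeniusType (V := Fin A → K) (U := ⊥) (W := ⊥) (by simp) (by simp)
      (by simp) (by simp)]
  constructor
  · rintro ⟨F, hF⟩
    by_contra hA1
    obtain ⟨φ, hφ⟩ := exists_forall_apply_eq_trace_comp F
    -- The representing `φ` lies in the kernel of its own form, so it is scalar; then the form
    -- vanishes and even the matrix unit `x` below would have to be scalar.
    have hcomm : ∀ y : End K (Fin A → K), F (φ * y - y * φ) = 0 := fun y => by
      rw [hφ]
      have : LinearMap.trace K (Fin A → K) (φ * (φ * y)) =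
          LinearMap.trace K (Fin A → K) (φ * (y * φ)) := by
        rw [LinearMap.trace_mul_comm K φ (φ * y), mul_assoc]
      change LinearMap.trace K (Fin A → K) (φ * (φ * y - y * φ)) = 0
      rw [mul_sub, map_sub, this, sub_self]
    obtain ⟨t, rfl⟩ := hF φ bot_le bot_le fun y _ _ => hcomm y
    let i : Fin A := ⟨0, hA⟩
    let j : Fin A := ⟨1, by omega⟩
    have hij : i ≠ j := by simp [i, j]
    let x : End K (Fin A → K) := (LinearMap.proj i : Dual K (Fin A → K)).smulRight (Pi.single i 1)
    obtain ⟨c, hc⟩ := hF x bot_le bot_le fun y _ _ => by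
      rw [hφ]
      change LinearMap.trace K (Fin A → K) ((t • 1) * (x * y - y * x)) = 0
      rw [smul_mul_assoc, one_mul, map_smul, map_sub, LinearMap.trace_mul_comm, sub_self, smul_zero]
    have h1 := congrFun (LinearMap.congr_fun hc (Pi.single i 1)) i
    have h2 := congrFun (LinearMap.congr_fun hc (Pi.single j 1)) j
    have hc0 : c = 0 := by simpa [x, hij, hij.symm] using h2.symm
    simp [x, hc0] at h1
  · rintro rfl
    refine ⟨0, fun x _ _ _ => ⟨x 1 0, ?_⟩⟩
    apply LinearMap.ext
    intro v
    have hv : v = v 0 • (1 : Fin 1 → K) := by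
      ext k
      fin_cases k
      simp
    ext k
    fin_cases k
    conv_lhs => rw [hv]
    simp [mul_comm]

theorem isFrobeniusFlag_iff_gcd (A B C : ℕ) (h : 0 < A + B + C) :
    IsFrobeniusFlag K A B C ↔ Nat.gcd (A + B) (B + C) = 1 := by
  induction hs : A + B + C using Nat.strong_induction_on generalizing A B C with
  | _ s ih =>
  subst hs
  have flip : ∀ {A B C A' B' C' : ℕ}, (IsFrobeniusFlag K C B A ↔ IsFrobeniusFlag K A' B' C') →
      (IsFrobeniusFlag K A B C ↔ IsFrobeniusFlag K A' B' C') := fun h =>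
    (isFrobeniusFlag_reverse _ _ _).trans h
  have step : ∀ A' B' C', (IsFrobeniusFlag K A B C ↔ IsFrobeniusFlag K A' B' C') →
      A' + B' + C' < A + B + C → 0 < A' + B' + C' →
      Nat.gcd (A + B) (B + C) = Nat.gcd (A' + B') (B' + C') →
      (IsFrobeniusFlag K A B C ↔ Nat.gcd (A + B) (B + C) = 1) := by
    intro A' B' C' h1 h2 h3 h4
    rw [h1, h4]
    exact ih _ h2 A' B' C' h3 rfl
  rcases Nat.eq_zero_or_pos (B + C) with hBC | hBC
  · obtain rfl : B = 0 := by omega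
    obtain rfl : C = 0 := by omega
    rw [isFrobeniusFlag_zero_zero_iff (by omega)]
    simp
  rcases Nat.eq_zero_or_pos (A + B) with hAB | hAB
  · obtain rfl : A = 0 := by omega
    obtain rfl : B = 0 := by omega
    rw [isFrobeniusFlag_reverse, isFrobeniusFlag_zero_zero_iff (by omega)]
    simp
  rcases le_or_gt (B + C) A with h1 | h1
  · obtain ⟨E, rfl⟩ := Nat.exists_eq_add_of_le' h1
    refine step E B C (isFrobeniusFlag_add_left E B C) (by omega) (by omega) ?_
    rw [show E + (B + C) + B = (E + B) + (B + C) by omega, Nat.gcd_add_self_left]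
  rcases le_or_gt (A + B) C with h2 | h2
  · obtain ⟨E, rfl⟩ := Nat.exists_eq_add_of_le' h2
    refine step E B A (flip ?_) (by omega) (by omega) ?_
    · rw [add_comm A B]
      exact isFrobeniusFlag_add_left E B A
    · rw [show B + (E + (A + B)) = (E + B) + (A + B) by omega, Nat.gcd_add_self_right, Nat.gcd_comm,
        add_comm A B]
  rcases lt_or_ge B A with h3 | h3
  -- With `D = B + C - A`, the swap lowers the total size by `A - B` and keeps both arguments of the
  -- gcd.
  · obtain ⟨D, hD⟩ := Nat.exists_eq_add_of_le h1.le
    exact step B A D (isFrobeniusFlag_swap hD.symm) (by omega) (by omega)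
      (by rw [add_comm A B, hD])
  rcases lt_or_ge B C with h4 | h4
  · obtain ⟨D, hD⟩ := Nat.exists_eq_add_of_le h2.le
    exact step B C D (flip (isFrobeniusFlag_swap (by omega))) (by omega) (by omega)
      (by rw [hD, Nat.gcd_comm])
  -- Now `B` is at least `A` and `C`, so one swap does not shrink the flag; a swap, a reversal and a
  -- subtraction together remove `2 * A`.
  have push : ∀ A E : ℕ, (IsFrobeniusFlag K A B (E + 2 * A) ↔ IsFrobeniusFlag K E A B) := by
    intro A E
    refine (isFrobeniusFlag_swap (D := E + (A + B)) (by omega)).trans (flip ?_)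
    exact isFrobeniusFlag_add_left E A B
  rcases Nat.eq_zero_or_pos A with rfl | hA
  · rcases Nat.eq_zero_or_pos C with rfl | hC
    · rw [isFrobeniusFlag_zero_left, isFrobeniusFlag_zero_zero_iff (by omega)]
      simp
    · obtain ⟨E, rfl⟩ := Nat.exists_eq_add_of_le' h4
      refine step E 0 C ((isFrobeniusFlag_zero_left _ _).trans ?_) (by omega) (by omega) ?_
      · have := isFrobeniusFlag_add_left (K := K) E 0 C
        rwa [zero_add] at this
      · simp
  rcases Nat.eq_zero_or_pos C with rfl | hC
  · obtain ⟨E, rfl⟩ := Nat.exists_eq_add_of_le' h3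
    refine step E 0 A (flip ((isFrobeniusFlag_zero_left _ _).trans ?_)) (by omega) (by omega) ?_
    · have := isFrobeniusFlag_add_left (K := K) E 0 A
      rwa [zero_add] at this
    · rw [show A + (E + A) = A + (E + A + 0) by omega, Nat.gcd_add_self_left]
      simp [Nat.gcd_comm]
  rcases lt_trichotomy A C with h5 | rfl | h5
  · rcases le_or_gt C (2 * A) with h6 | h6
    -- Two swaps with a reversal between them give `G = 2 * A - C`, and the total drops by `C - A`.
    · obtain ⟨D, hD⟩ := Nat.exists_eq_add_of_le h1.le
      obtain ⟨G, hG⟩ := Nat.exists_eq_add_of_le (show D ≤ A + B by omega)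
      refine step A D G ((isFrobeniusFlag_swap hD.symm).trans
        (flip (isFrobeniusFlag_swap hG.symm))) (by omega) (by omega) ?_
      rw [hD, hG, Nat.gcd_comm]
    · obtain ⟨E, rfl⟩ := Nat.exists_eq_add_of_le' h6.le
      refine step E A B (push A E) (by omega) (by omega) ?_
      rw [show B + (E + 2 * A) = (E + A) + (A + B) by omega, Nat.gcd_add_self_right, Nat.gcd_comm]
  · refine iff_of_false (not_isFrobeniusFlag_of_pos hA (by omega)) ?_
    rw [add_comm B A, Nat.gcd_self]
    omega
  · rcases le_or_gt A (2 * C) with h6 | h6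
    · obtain ⟨D, hD⟩ := Nat.exists_eq_add_of_le h2.le
      obtain ⟨G, hG⟩ := Nat.exists_eq_add_of_le (show D ≤ C + B by omega)
      refine step C D G (flip ((isFrobeniusFlag_swap (D := D) (by omega)).trans
        (flip (isFrobeniusFlag_swap hG.symm)))) (by omega) (by omega) ?_
      rw [hD, ← hG, add_comm B C]
    · obtain ⟨E, rfl⟩ := Nat.exists_eq_add_of_le' h6.le
      refine step E C B (flip (push C E)) (by omega) (by omega) ?_
      rw [show E + 2 * C + B = (E + C) + (B + C) by omega, Nat.gcd_add_self_left, add_comm B C]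

end Numerical

/-! ### From the seaweed algebra to a pair of subspaces -/

section Seaweed

theorem isFrobeniusLie_iff_exists (K L : Type*) [Field K] [LieRing L] [LieAlgebra K L]
    [FiniteDimensional K L] :
    IsFrobeniusLie K L ↔ ∃ F : Dual K L, ∀ x : L, (∀ y : L, F ⁅x, y⁆ = 0) → x = 0 := by
  have hker : ∀ F : Dual K L, finrank K (LinearMap.ker (kirillovForm F)) = 0 ↔
      ∀ x : L, (∀ y : L, F ⁅x, y⁆ = 0) → x = 0 := by
    intro F
    rw [Submodule.finrank_eq_zero, LinearMap.ker_eq_bot']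
    refine forall_congr' fun x => imp_congr_left ?_
    rw [LinearMap.ext_iff]
    rfl
  simp only [IsFrobeniusLie, lieIndex, ← hker]
  constructor
  · intro h
    have := Nat.sInf_mem (Set.range_nonempty
      fun F : Dual K L => finrank K (LinearMap.ker (kirillovForm F)))
    obtain ⟨F, hF⟩ := this
    exact ⟨F, hF.trans h⟩
  · rintro ⟨F, hF⟩
    exact Nat.eq_zero_of_le_zero ((ciInf_le (OrderBot.bddBelow _) F).trans_eq hF)

variable {K : Type*} [Field K] {n : ℕ}

theorem mem_lieSubalgebra_iInf {L ι : Type*} [LieRing L] [LieAlgebra K L]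
    (S : ι → LieSubalgebra K L) (x : L) : x ∈ ⨅ i, S i ↔ ∀ i, x ∈ S i := by
  rw [iInf, ← SetLike.mem_coe, LieSubalgebra.coe_sInf]
  simp

theorem mem_stabilizerLie (U : Submodule K (Fin n → K)) (A : Matrix (Fin n) (Fin n) K) :
    A ∈ stabilizerLie U ↔ U ≤ U.comap (Matrix.toLin' A) := Iff.rfl

theorem upperFlag_eq_span (x : List ℕ) (i : ℕ) :
    upperFlag K n x i =
      Submodule.span K (Pi.basisFun K (Fin n) '' {k | (k : ℕ) < (x.take i).sum}) := by
  unfold upperFlag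
  congr 1
  ext v
  simp [eq_comm]

theorem lowerFlag_eq_span (y : List ℕ) (j : ℕ) :
    lowerFlag K n y j =
      Submodule.span K (Pi.basisFun K (Fin n) '' {k | (y.take j).sum ≤ (k : ℕ)}) := by
  unfold lowerFlag
  congr 1
  ext v
  simp [eq_comm]

theorem span_basisFun_image_inf (s t : Set (Fin n)) :
    Submodule.span K (Pi.basisFun K (Fin n) '' s) ⊓ Submodule.span K (Pi.basisFun K (Fin n) '' t) =
      Submodule.span K (Pi.basisFun K (Fin n) '' (s ∩ t)) := by
  ext v
  simp only [Submodule.mem_inf, Basis.mem_span_image, Set.subset_inter_iff]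

theorem finrank_span_basisFun_image (s : Set (Fin n)) :
    finrank K (Submodule.span K (Pi.basisFun K (Fin n) '' s)) = s.ncard := by
  classical
  have h := finrank_span_eq_card (R := K) (b := fun k : s => Pi.basisFun K (Fin n) k)
    ((Pi.basisFun K (Fin n)).linearIndependent.comp _ Subtype.val_injective)
  rw [Set.image_eq_range, h, Set.ncard_eq_toFinset_card', Set.toFinset_card]

theorem ncard_fin_interval (l u : ℕ) (hu : u ≤ n) :
    {k : Fin n | l ≤ (k : ℕ) ∧ (k : ℕ) < u}.ncard = u - l := by
  rw [← Set.ncard_image_of_injective _ Fin.val_injective]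
  have : Fin.val '' {k : Fin n | l ≤ (k : ℕ) ∧ (k : ℕ) < u} = (Finset.Ico l u : Set ℕ) := by
    ext m
    simp only [Set.mem_image, Set.mem_ofPred_eq, Finset.coe_Ico, Set.mem_Ico]
    constructor
    · rintro ⟨k, hk, rfl⟩
      exact hk
    · intro hm
      exact ⟨⟨m, by omega⟩, hm, rfl⟩
  rw [this, Set.ncard_coe_finset, Nat.card_Ico]

theorem mem_seaweed_iff {a b c d : ℕ} (hab : a + b = n) (hcd : c + d = n)
    (A : Matrix (Fin n) (Fin n) K) :
    A ∈ seaweed K n [a, b] [c, d] ↔ A.trace = 0 ∧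
      upperFlag K n [a, b] 1 ≤ (upperFlag K n [a, b] 1).comap (Matrix.toLin' A) ∧
      lowerFlag K n [c, d] 1 ≤ (lowerFlag K n [c, d] 1).comap (Matrix.toLin' A) := by
  have hspan : Submodule.span K (Pi.basisFun K (Fin n) '' Set.univ) = ⊤ := by
    rw [Set.image_univ, Basis.span_eq]
  have hu0 : upperFlag K n [a, b] 0 = ⊥ := by simp [upperFlag_eq_span]
  have hu2 : upperFlag K n [a, b] 2 = ⊤ := by
    rw [upperFlag_eq_span, ← hspan]; simp [hab]
  have hl0 : lowerFlag K n [c, d] 0 = ⊤ := by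
    rw [lowerFlag_eq_span, ← hspan]; simp
  have hl2 : lowerFlag K n [c, d] 2 = ⊥ := by
    rw [lowerFlag_eq_span]; simp [hcd]
  have hbot : A ∈ stabilizerLie (⊥ : Submodule K (Fin n → K)) := by
    rw [mem_stabilizerLie]; exact bot_le
  have htop : A ∈ stabilizerLie (⊤ : Submodule K (Fin n → K)) := by
    rw [mem_stabilizerLie, Submodule.comap_top]
  have h1 : A ∈ (⨅ i : Fin ([a, b].length + 1), stabilizerLie (upperFlag K n [a, b] i)) ↔
      upperFlag K n [a, b] 1 ≤ (upperFlag K n [a, b] 1).comap (Matrix.toLin' A) := by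
    rw [mem_lieSubalgebra_iInf]
    change (∀ i : Fin 3, _) ↔ _
    rw [Fin.forall_fin_succ, Fin.forall_fin_two, ← mem_stabilizerLie]
    simp [hu0, hu2, hbot, htop]
  have h2 : A ∈ (⨅ j : Fin ([c, d].length + 1), stabilizerLie (lowerFlag K n [c, d] j)) ↔
      lowerFlag K n [c, d] 1 ≤ (lowerFlag K n [c, d] 1).comap (Matrix.toLin' A) := by
    rw [mem_lieSubalgebra_iInf]
    change (∀ i : Fin 3, _) ↔ _
    rw [Fin.forall_fin_succ, Fin.forall_fin_two, ← mem_stabilizerLie]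
    simp [hl0, hl2, hbot, htop]
  rw [← h1, ← h2, ← and_assoc]
  rfl

/-- If a Lie algebra of traceless matrices is cut out by the preservation of two subspaces, it is
Frobenius if and only if the pair of subspaces is. -/
theorem isFrobeniusLie_iff_isFrobeniusPair [CharZero K] (hn : 0 < n)
    (L : LieSubalgebra K (Matrix (Fin n) (Fin n) K)) (U W : Submodule K (Fin n → K))
    (hL : ∀ A, A ∈ L ↔ A.trace = 0 ∧ U ≤ U.comap (Matrix.toLin' A) ∧
      W ≤ W.comap (Matrix.toLin' A)) :
    IsFrobeniusLie K L ↔ IsFrobeniusPair U W := by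
  have hn0 : (n : K) ≠ 0 := by exact_mod_cast hn.ne'
  -- Subtracting the scalar `tr x / n` lands in `L` without changing any commutator.
  have htraceless : ∀ x : End K (Fin n → K), U ≤ U.comap x → W ≤ W.comap x →
      LinearMap.toMatrix' x - ((LinearMap.toMatrix' x).trace / n) • 1 ∈ L := by
    intro x hU hW
    have hpres : ∀ S : Submodule K (Fin n → K), S ≤ S.comap x → S ≤ S.comap (Matrix.toLin'
        (LinearMap.toMatrix' x - ((LinearMap.toMatrix' x).trace / n) • 1)) := by
      intro S hS v hv
      rw [Submodule.mem_comap, map_sub, map_smul, Matrix.toLin'_toMatrix', Matrix.toLin'_one]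
      exact S.sub_mem (hS hv) (S.smul_mem _ hv)
    refine (hL _).2 ⟨?_, hpres U hU, hpres W hW⟩
    rw [Matrix.trace_sub, Matrix.trace_smul, Matrix.trace_one, Fintype.card_fin, smul_eq_mul,
      div_mul_cancel₀ _ hn0, sub_self]
  have hcomm : ∀ (X Y : Matrix (Fin n) (Fin n) K) (t : K),
      (X - t • 1) * Y - Y * (X - t • 1) = X * Y - Y * X := by
    intro X Y t
    simp only [sub_mul, mul_sub, smul_mul_assoc, mul_smul_comm, one_mul, mul_one]
    abel
  rw [isFrobeniusLie_iff_exists]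
  constructor
  · rintro ⟨F, hF⟩
    obtain ⟨G, hG⟩ := LinearMap.exists_extend (p := L.toSubmodule) F
    have hG' : ∀ x : L, G x = F x := LinearMap.congr_fun hG
    refine ⟨G ∘ₗ LinearMap.toMatrix'.toLinearMap, fun x hU hW hk => ?_⟩
    have h0 := hF ⟨_, htraceless x hU hW⟩ fun Y => by
      have hY := (hL Y).1 Y.2
      rw [← hG', ← hk (Matrix.toLin' Y) hY.2.1 hY.2.2]
      change G (_ * (Y : Matrix (Fin n) (Fin n) K) - Y * _) = G (LinearMap.toMatrix' _)
      rw [hcomm, map_sub LinearMap.toMatrix', LinearMap.toMatrix'_mul, LinearMap.toMatrix'_mul,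
        LinearMap.toMatrix'_toLin']
    have h1 : LinearMap.toMatrix' x = ((LinearMap.toMatrix' x).trace / n) • 1 :=
      sub_eq_zero.1 (congrArg Subtype.val h0)
    refine ⟨(LinearMap.toMatrix' x).trace / n, ?_⟩
    rw [← Matrix.toLin'_toMatrix' x]
    conv_lhs => rw [h1]
    rw [map_smul, Matrix.toLin'_one, Matrix.toLin'_toMatrix']
    rfl
  · rintro ⟨F, hF⟩
    refine ⟨F ∘ₗ Matrix.toLin'.toLinearMap ∘ₗ L.toSubmodule.subtype, fun X hk => ?_⟩
    have hX := (hL X).1 X.2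
    obtain ⟨t, ht⟩ := hF (Matrix.toLin' X) hX.2.1 hX.2.2 fun y hyU hyW => by
      rw [← neg_eq_zero, ← map_neg, neg_sub]
      have := hk ⟨_, htraceless y hyU hyW⟩
      change F (Matrix.toLin' ((X : Matrix (Fin n) (Fin n) K) * _ - _ * X)) = 0 at this
      rw [← neg_eq_zero, ← map_neg, ← map_neg, neg_sub, hcomm, map_sub, Matrix.toLin'_mul,
        Matrix.toLin'_mul, Matrix.toLin'_toMatrix'] at this
      exact this
    have hXt : (X : Matrix (Fin n) (Fin n) K) = t • 1 := by
      apply Matrix.toLin'.injective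
      rw [ht, map_smul, Matrix.toLin'_one]
      rfl
    have htr := hX.1
    rw [hXt, Matrix.trace_smul, Matrix.trace_one, Fintype.card_fin, smul_eq_mul, mul_eq_zero,
      or_iff_left hn0] at htr
    rw [htr, zero_smul] at hXt
    exact Subtype.ext hXt

end Seaweed

theorem mainTheorem2 {K : Type*} [Field K] [CharZero K] (n a b c d : ℕ) (hn : 0 < n)
    (hab : a + b = n) (hcd : c + d = n) :
    IsFrobeniusLie K (seaweed K n [a, b] [c, d]) ↔ Int.gcd ((a : ℤ) - (c : ℤ)) (n : ℤ) = 1 := by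
  rw [isFrobeniusLie_iff_isFrobeniusPair hn _ _ _ (mem_seaweed_iff hab hcd)]
  have hU : finrank K (upperFlag K n [a, b] 1) = a := by
    rw [upperFlag_eq_span, finrank_span_basisFun_image]
    simpa using ncard_fin_interval (n := n) 0 a (by omega)
  have hW : finrank K (lowerFlag K n [c, d] 1) = d := by
    rw [lowerFlag_eq_span, finrank_span_basisFun_image]
    have := ncard_fin_interval (n := n) c n le_rfl
    simp only [Fin.is_lt, and_true] at this
    simp only [List.take_succ_cons, List.take_zero, List.sum_cons, List.sum_nil, add_zero, this]
    omega
  have hUW : finrank K (upperFlag K n [a, b] 1 ⊓ lowerFlag K n [c, d] 1 :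
      Submodule K (Fin n → K)) = a - c := by
    rw [upperFlag_eq_span, lowerFlag_eq_span, span_basisFun_image_inf, finrank_span_basisFun_image,
      ← ncard_fin_interval (n := n) c a (by omega)]
    congr 1
    ext k
    simp [and_comm]
  -- The dimensions `d + c`, `a`, `d`, `a - c` are those of the generic pair for the flag with
  -- blocks `a`, `d`, `c`.
  rw [isFrobeniusPair_iff_isFrobeniusType (n := d + c) (by simp; omega) hU hW hUW,
    ← isFrobeniusFlag_iff_isFrobeniusType (by omega), isFrobeniusFlag_iff_gcd _ _ _ (by omega),
    ← Int.gcd_natCast_natCast, show ((a + d : ℕ) : ℤ) = (a : ℤ) - c + n by push_cast [← hcd]; ring,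
    show d + c = n by omega, Int.gcd_add_self_left]
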